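/- All graphs are finite and simple. A vertex cover of $G$ is a set of vertices that meets every edge; $\mathrm{mvc}(G)$ is the minimum size of a vertex cover. In the eternal vertex cover game, guards occupy vertices, at most one per vertex. In each round the attacker picks an edge, and in response all guards move in parallel, each guard staying where it is or moving to an adjacent vertex, so that at least one guard moves across the attacked edge and no two guards end on the same vertex. A family $\mathcal C$ of vertex covers of the same size is an eternal vertex cover class of $G$ if from every configuration in $\mathcal C$ every attack can be answered by moving to a configuration in $\mathcal C$; $\mathrm{evc}(G)$ is the least size of the members of a nonempty eternal vertex cover class. Let $\mathcal F$ be the class of all connected graphs $G$ such that each minimum vertex cover of $G$ that contains all cut vertices of $G$ induces a connected subgraph (the empty set counts as connected). Let $\mathcal H$ be a hereditary class of graphs, that is, an isomorphism-closed class that contains all induced subgraphs of its members. Suppose that every connected graph in $\mathcal H$ belongs to $\mathcal F$ and that $\mathrm{mvc}(G)$ can be computed in polynomial time for graphs $G$ given from $\mathcal H$. Then, for graphs $G$ given from $\mathcal H$: 1. it can be decided in polynomial time whether $\mathrm{evc}(G)=\mathrm{mvc}(G)$; 2. for those $G$ with $\mathrm{evc}(G)=\mathrm{mvc}(G)$ there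 is a polynomial-time (per-round) strategy for guard movements with $\mathrm{evc}(G)$ guards: there are two polynomial-time algorithms, one that computes an initial configuration from $G$, and one that computes from $G$, the current configuration and the attacked edge the guard movements answering the attack, such that the play stays in an eternal vertex cover class of $G$ whose members have size $\mathrm{evc}(G)$; 3. for those $G$ that are biconnected (connected and without cut vertices), $\mathrm{evc}(G)$ can be computed in polynomial time, and there is a polynomial-time (per-round) strategy, in the same sense, for guard movements with $\mathrm{evc}(G)$ guards. -/

import Mathlib

namespace EternalVC

/-! ### A programming language with a running time

Programs compute on binary trees (as in Lisp or in Jones' language WHILE). Every elementary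
operation is charged the size of the tree it copies, so the total amount of data that a run ever
creates is bounded by its cost, and polynomial time here agrees with polynomial time on Turing
machines. -/

/-- Binary trees, the data that programs work on. -/
inductive Data : Type
  | nil : Data
  | cons : Data → Data → Data

/-- The number of nodes, counting leaves. -/
def Data.size : Data → ℕ
  | .nil => 1
  | .cons a b => a.size + b.size + 1

/-- The left subtree (`nil` for a leaf). -/
def Data.fst : Data → Data
  | .nil => .nil
  | .cons a _ => a

/-- The right subtree (`nil` for a leaf). -/
def Data.snd : Data → Data
  | .nil => .nil
  | .cons _ b => b

/-- Programs; each is run on one tree and, if it halts, yields one tree.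
* `skip` returns its input, `nil` returns a leaf, `fst` and `snd` return a subtree;
* `pair p q` runs `p` and `q` on the input and joins the two results;
* `seq p q` runs `p` and then `q` on the result;
* `ite c p q` runs `c` on the input, and then, again on the input, `q` if `c` returned a leaf and
  `p` otherwise;
* `loop c p` runs `c` on the current tree; if the result is a leaf it stops and returns the current
  tree, otherwise it replaces the current tree by the result of `p` on it and starts again. -/
inductive Prog : Type
  | skip : Prog
  | nil : Prog
  | fst : Prog
  | snd : Prog
  | pair : Prog → Prog → Prog
  | seq : Prog → Prog → Prog
  | ite : Prog → Prog → Prog → Prog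
  | loop : Prog → Prog → Prog

/-- `Runs p x y t`: on input `x`, the program `p` halts with output `y` after running for `t`
units of time. -/
inductive Runs : Prog → Data → Data → ℕ → Prop
  | skip (x : Data) : Runs .skip x x (x.size + 1)
  | nil (x : Data) : Runs .nil x .nil (x.size + 1)
  | fst (x : Data) : Runs .fst x x.fst (x.size + 1)
  | snd (x : Data) : Runs .snd x x.snd (x.size + 1)
  | pair {p q : Prog} {x y z : Data} {s t : ℕ} :
      Runs p x y s → Runs q x z t → Runs (.pair p q) x (.cons y z) (s + t + x.size + 1)
  | seq {p q : Prog} {x y z : Data} {s t : ℕ} :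
      Runs p x y s → Runs q y z t → Runs (.seq p q) x z (s + t + 1)
  | ite_true {c p q : Prog} {x a b y : Data} {s t : ℕ} :
      Runs c x (.cons a b) s → Runs p x y t → Runs (.ite c p q) x y (s + t + x.size + 1)
  | ite_false {c p q : Prog} {x y : Data} {s t : ℕ} :
      Runs c x .nil s → Runs q x y t → Runs (.ite c p q) x y (s + t + x.size + 1)
  | loop_stop {c p : Prog} {x : Data} {s : ℕ} :
      Runs c x .nil s → Runs (.loop c p) x x (s + x.size + 1)
  | loop_step {c p : Prog} {x a b y z : Data} {r s t : ℕ} :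
      Runs c x (.cons a b) r → Runs p x y s → Runs (.loop c p) y z t →
      Runs (.loop c p) x z (r + s + t + x.size + 1)

/-- Programs are deterministic: the output and the running time are determined by the input. -/
theorem Runs.unique {p : Prog} {x y y' : Data} {t t' : ℕ} (h : Runs p x y t)
    (h' : Runs p x y' t') : y = y' ∧ t = t' := by
  induction h generalizing y' t' <;> cases h' <;> grind

/-! ### Finite graphs and their encoding -/

/-- A finite graph, with vertices `0, …, n - 1`. -/
abbrev FinGraph : Type := Σ n : ℕ, SimpleGraph (Fin n)

/-- Lists as right combs. -/
def encList (l : List Data) : Data := l.foldr Data.cons Data.nil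

/-- Unary numbers (all numbers that are encoded here are at most the number of vertices). -/
def encNat (k : ℕ) : Data := encList (List.replicate k Data.nil)

open Classical in
/-- Truth values: false is a leaf, true is not. -/
noncomputable def encBool (P : Prop) : Data := if P then .cons .nil .nil else .nil

/-- The adjacency matrix, as the list of its rows. -/
noncomputable def encGraph (G : FinGraph) : Data :=
  encList (List.ofFn fun i : Fin G.1 => encList (List.ofFn fun j : Fin G.1 => encBool (G.2.Adj i j)))

/-- A set of vertices, as its list of membership bits. -/
noncomputable def encSet {n : ℕ} (S : Finset (Fin n)) : Data :=
  encList (List.ofFn fun i : Fin n => encBool (i ∈ S))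

/-- A map on vertices, as its list of values. -/
def encMap {n : ℕ} (f : Fin n → Fin n) : Data :=
  encList (List.ofFn fun i : Fin n => encNat (f i))

/-- The situation in one round of the game: the graph, the vertices occupied by guards, and the
attacked edge `uv`. -/
noncomputable def encRound (G : FinGraph) (S : Finset (Fin G.1)) (u v : Fin G.1) : Data :=
  .cons (encGraph G) (.cons (encSet S) (.cons (encNat u) (encNat v)))

/-! ### Polynomial time on a class of graphs -/

/-- The number `f G` can be computed in polynomial time when `G` is given from the class `P`. -/
def PolyTimeComputableOn (P : FinGraph → Prop) (f : FinGraph → ℕ) : Prop :=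
  ∃ (p : Prog) (q : Polynomial ℕ), ∀ G, P G →
    ∃ t, Runs p (encGraph G) (encNat (f G)) t ∧ t ≤ q.eval (encGraph G).size

/-- It can be decided in polynomial time whether `D G` holds when `G` is given from the
class `P`. -/
def PolyTimeDecidableOn (P : FinGraph → Prop) (D : FinGraph → Prop) : Prop :=
  ∃ (p : Prog) (q : Polynomial ℕ), ∀ G, P G →
    ∃ t, Runs p (encGraph G) (encBool (D G)) t ∧ t ≤ q.eval (encGraph G).size

/-! ### Vertex covers and the eternal vertex cover game -/

/-- The minimum vertex cover number. -/
noncomputable def mvc {n : ℕ} (G : SimpleGraph (Fin n)) : ℕ := G.vertexCoverNum.toNat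

/-- With guards on the vertices in `S`, moving each guard from its vertex `w` to `f w` is a legal
answer to an attack on the edge `uv`: each guard stays or moves to an adjacent vertex, no two
guards end on the same vertex, and some guard moves across `uv`. -/
def IsDefence {n : ℕ} (G : SimpleGraph (Fin n)) (S : Finset (Fin n)) (u v : Fin n)
    (f : Fin n → Fin n) : Prop :=
  (∀ w ∈ S, f w = w ∨ G.Adj w (f w)) ∧ Set.InjOn f S ∧
    ((u ∈ S ∧ f u = v) ∨ (v ∈ S ∧ f v = u))

/-- `C` is an eternal vertex cover class all of whose configurations have `k` guards: from each
configuration in `C`, each attack can be answered by moving to a configuration in `C`. -/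
def IsEVCClass {n : ℕ} (G : SimpleGraph (Fin n)) (k : ℕ) (C : Set (Finset (Fin n))) : Prop :=
  (∀ S ∈ C, G.IsVertexCover S ∧ S.card = k) ∧
    ∀ S ∈ C, ∀ u v, G.Adj u v → ∃ f, IsDefence G S u v f ∧ S.image f ∈ C

/-- The eternal vertex cover number. -/
noncomputable def evc {n : ℕ} (G : SimpleGraph (Fin n)) : ℕ :=
  sInf {k | ∃ C : Set (Finset (Fin n)), C.Nonempty ∧ IsEVCClass G k C}

/-- The minimum that defines `evc` is over a nonempty set: guards on all vertices win, by swapping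
the two guards on the attacked edge. -/
theorem evc_spec {n : ℕ} (G : SimpleGraph (Fin n)) :
    ∃ C : Set (Finset (Fin n)), C.Nonempty ∧ IsEVCClass G (evc G) C := by
  refine Nat.sInf_mem (s := {k | ∃ C : Set (Finset (Fin n)), C.Nonempty ∧ IsEVCClass G k C})
    ⟨n, {Finset.univ}, Set.singleton_nonempty _, ?_, ?_⟩
  · rintro S rfl
    simp
  · rintro S rfl u v huv
    refine ⟨Equiv.swap u v, ⟨?_, (Equiv.swap u v).injective.injOn, ?_⟩, ?_⟩
    · intro w _
      by_cases h1 : w = u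
      · subst h1; simp [huv]
      · by_cases h2 : w = v
        · subst h2; simp [huv.symm]
        · simp [Equiv.swap_apply_of_ne_of_ne h1 h2]
    · simp
    · exact Finset.image_univ_equiv (Equiv.swap u v)

/-- For graphs in the class `P` there is a polynomial-time strategy for guard movements that uses
`evc G` guards: `start` computes an initial configuration from `G`, and in each round `step`
computes the guard movements from `G`, the current configuration and the attacked edge, so that the
play never leaves an eternal vertex cover class `C` with `evc G` guards. -/
def HasPolyTimeStrategyOn (P : FinGraph → Prop) : Prop :=
  ∃ (start step : Prog) (q : Polynomial ℕ), ∀ G, P G →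
    ∃ C : Set (Finset (Fin G.1)), IsEVCClass G.2 (evc G.2) C ∧
      (∃ S ∈ C, ∃ t, Runs start (encGraph G) (encSet S) t ∧ t ≤ q.eval (encGraph G).size) ∧
      ∀ S ∈ C, ∀ u v, G.2.Adj u v →
        ∃ f, IsDefence G.2 S u v f ∧ S.image f ∈ C ∧
          ∃ t, Runs step (encRound G S u v) (encMap f) t ∧ t ≤ q.eval (encRound G S u v).size

/-! ### Classes of graphs -/

/-- `x` is a cut vertex: its removal separates two vertices of one component. -/
def IsCutVertex {n : ℕ} (G : SimpleGraph (Fin n)) (x : Fin n) : Prop :=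
  ∃ (u v : Fin n) (hu : u ∈ ({x}ᶜ : Set (Fin n))) (hv : v ∈ ({x}ᶜ : Set (Fin n))),
    G.Reachable u v ∧ ¬ (G.induce {x}ᶜ).Reachable ⟨u, hu⟩ ⟨v, hv⟩

/-- Connected, without cut vertices. -/
def IsBiconnected {n : ℕ} (G : SimpleGraph (Fin n)) : Prop :=
  G.Connected ∧ ∀ x, ¬ IsCutVertex G x

/-- The class of all connected graphs in which each minimum vertex cover that contains all cut
vertices induces a connected subgraph. (The empty set, which is the minimum vertex cover of the
graph with one vertex, counts as connected.) -/
def InClassF {n : ℕ} (G : SimpleGraph (Fin n)) : Prop :=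
  G.Connected ∧ ∀ S : Finset (Fin n), G.IsVertexCover S → S.card = mvc G →
    (∀ x, IsCutVertex G x → x ∈ S) → (G.induce (S : Set (Fin n))).Preconnected

/-- A class of graphs is hereditary if it contains, with each graph, all its induced subgraphs
(hence also, as for every class of graphs, all isomorphic graphs). -/
def IsHereditary (H : FinGraph → Prop) : Prop :=
  ∀ G G' : FinGraph, H G → Nonempty (G'.2 ↪g G.2) → H G'

end EternalVC

/-! The criterion behind all three parts is `Extendable`: each non-isolated vertex lies, together
with all cut vertices, in some minimum vertex cover. For graphs in the class it is equivalent to evc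
= mvc.

Necessity. With mvc guards every cut vertex `x` is always occupied. If `x` is empty, an attack on an
edge from `x` into one side of the cut draws a guard out of that side, and none can enter it through
`x`. Doing this for either side and gluing the two reduced halves with `x` gives a cover that is too
small (`IsEVCClass.cutSet_subset`). An attack at `v` forces a guard onto `v` now or in the next
round, so the resulting configuration extends `v` and the cut vertices.

Sufficiency. The configurations are all minimum covers containing the cut vertices. If `S` is
attacked on `ab` with `b` empty, choose such a cover `S'` that also contains `b` and has
inclusion-maximal intersection with `S`. The graph between `S \ S'` and `S' \ S` is bipartite, and
maximality implies that for every `x` in `S \ S'` it has a perfect matching after `x` and `b` are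
deleted (`card_le_mu_rest`, with Hall's theorem in `exists_partner`). Connectedness of `S` inside
the component of `a` (`conn_of_reachable`) supplies a path in `S` from `a` to some such `x`. The
guards shift by one along this path towards `b`, and the others in `S \ S'` move along the matching
(`shift_spec`).

If a biconnected graph is not extendable, evc exceeds mvc, and one extra guard suffices: a fixed
minimum cover `S₀` is connected, and the surplus guard is transferred to any attacked empty vertex
by a shift along a path through `S₀`.

Complexity. All choices reduce to values of mvc on induced subgraphs, which heredity makes
available. A set `Y` lies in a minimum cover iff deleting it lowers mvc by `|Y|`, so covers with the
required maximality are found greedily (`pass_spec`, `greedyCover_maximal`). Matching partners are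
recognised by mvc as well, by König duality. The relation `PT` packages polynomial-time computation
and is closed under pairing, branching and iteration with polynomially bounded state. -/

namespace EternalVC

/-! ### Polynomial-time computable families of trees -/

theorem Data.size_pos (x : Data) : 1 ≤ x.size := by
  cases x <;> simp [Data.size]

theorem Data.fst_size_le (x : Data) : x.fst.size ≤ x.size := by
  cases x
  · simp [Data.fst]
  · simp only [Data.size, Data.fst]; omega

theorem Data.snd_size_le (x : Data) : x.snd.size ≤ x.size := by
  cases x
  · simp [Data.snd]
  · simp only [Data.size, Data.snd]; omega

/-- Each operation is charged for what it copies, so a time bound is also a bound on the output.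
This is what makes polynomial time closed under composition. -/
theorem Runs.size_le {p : Prog} {x y : Data} {t : ℕ} (h : Runs p x y t) : y.size ≤ t := by
  induction h with
  | skip x => omega
  | nil x => simp [Data.size]
  | fst x => have := x.fst_size_le; omega
  | snd x => have := x.snd_size_le; omega
  | pair => simp only [Data.size]; omega
  | _ => omega

/-- `p` maps `x` to `y` in at most `b` units of time. -/
def RunsLe (p : Prog) (x y : Data) (b : ℕ) : Prop := ∃ t, Runs p x y t ∧ t ≤ b

theorem RunsLe.mono {p : Prog} {x y : Data} {b b' : ℕ} (h : RunsLe p x y b) (hb : b ≤ b') :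
    RunsLe p x y b' :=
  let ⟨t, ht, h⟩ := h; ⟨t, ht, h.trans hb⟩

theorem RunsLe.size_le {p : Prog} {x y : Data} {b : ℕ} (h : RunsLe p x y b) : y.size ≤ b :=
  let ⟨_, ht, h⟩ := h; ht.size_le.trans h

theorem RunsLe.skip (x : Data) : RunsLe .skip x x (x.size + 1) := ⟨_, .skip x, le_rfl⟩

theorem RunsLe.fst (x : Data) : RunsLe .fst x x.fst (x.size + 1) := ⟨_, .fst x, le_rfl⟩

theorem RunsLe.snd (x : Data) : RunsLe .snd x x.snd (x.size + 1) := ⟨_, .snd x, le_rfl⟩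

theorem RunsLe.pair {p q : Prog} {x y z : Data} {s t : ℕ} (h : RunsLe p x y s)
    (h' : RunsLe q x z t) : RunsLe (.pair p q) x (.cons y z) (s + t + x.size + 1) := by
  obtain ⟨s', h, hs⟩ := h
  obtain ⟨t', h', ht⟩ := h'
  exact ⟨_, .pair h h', by omega⟩

theorem RunsLe.seq {p q : Prog} {x y z : Data} {s t : ℕ} (h : RunsLe p x y s)
    (h' : RunsLe q y z t) : RunsLe (.seq p q) x z (s + t + 1) := by
  obtain ⟨s', h, hs⟩ := h
  obtain ⟨t', h', ht⟩ := h'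
  exact ⟨_, .seq h h', by omega⟩

/-- `f` is bounded by a polynomial in `c`. -/
def PolyBdd {ι : Type} (c f : ι → ℕ) : Prop := ∃ q : Polynomial ℕ, ∀ i, f i ≤ q.eval (c i)

theorem eval_mono (q : Polynomial ℕ) {a b : ℕ} (h : a ≤ b) : q.eval a ≤ q.eval b := by
  simp only [Polynomial.eval_eq_sum, Polynomial.sum]
  gcongr

namespace PolyBdd

variable {ι : Type} {c f g : ι → ℕ}

theorem self (c : ι → ℕ) : PolyBdd c c := ⟨.X, by simp⟩

theorem const (c : ι → ℕ) (k : ℕ) : PolyBdd c fun _ => k := ⟨.C k, by simp⟩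

theorem mono (h : PolyBdd c g) (hfg : ∀ i, f i ≤ g i) : PolyBdd c f :=
  let ⟨q, hq⟩ := h; ⟨q, fun i => (hfg i).trans (hq i)⟩

theorem add (hf : PolyBdd c f) (hg : PolyBdd c g) : PolyBdd c fun i => f i + g i := by
  obtain ⟨q, hq⟩ := hf
  obtain ⟨r, hr⟩ := hg
  exact ⟨q + r, fun i => by simpa using add_le_add (hq i) (hr i)⟩

theorem mul (hf : PolyBdd c f) (hg : PolyBdd c g) : PolyBdd c fun i => f i * g i := by
  obtain ⟨q, hq⟩ := hf
  obtain ⟨r, hr⟩ := hg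
  exact ⟨q * r, fun i => by simpa using Nat.mul_le_mul (hq i) (hr i)⟩

theorem trans (hf : PolyBdd c f) (hg : PolyBdd f g) : PolyBdd c g := by
  obtain ⟨q, hq⟩ := hf
  obtain ⟨r, hr⟩ := hg
  exact ⟨r.comp q, fun i => by
    simpa [Polynomial.eval_comp] using (hr i).trans (eval_mono r (hq i))⟩

theorem eval (q : Polynomial ℕ) (hf : PolyBdd c f) : PolyBdd c fun i => q.eval (f i) :=
  hf.trans ⟨q, fun _ => le_rfl⟩

theorem reindex {κ : Type} (h : PolyBdd c f) (g : κ → ι) :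
    PolyBdd (fun k => c (g k)) fun k => f (g k) :=
  let ⟨q, hq⟩ := h; ⟨q, fun k => hq (g k)⟩

end PolyBdd

/-- One program maps `a i` to `b i` for all `i`, in time polynomial in the size of `a i`. -/
def PT {ι : Type} (a b : ι → Data) : Prop :=
  ∃ (p : Prog) (q : Polynomial ℕ), ∀ i, RunsLe p (a i) (b i) (q.eval (a i).size)

namespace PT

variable {ι : Type} {c a b : ι → Data}

theorem of_polyBdd (p : Prog) {t : ι → ℕ} (ht : PolyBdd (fun i => (c i).size) t)
    (h : ∀ i, RunsLe p (c i) (a i) (t i)) : PT c a :=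
  let ⟨q, hq⟩ := ht; ⟨p, q, fun i => (h i).mono (hq i)⟩

theorem polyBdd (h : PT c a) : PolyBdd (fun i => (c i).size) fun i => (a i).size :=
  let ⟨_, q, h⟩ := h; ⟨q, fun i => (h i).size_le⟩

theorem refl (c : ι → Data) : PT c c :=
  of_polyBdd .skip ((PolyBdd.self _).add (.const _ 1)) fun i => .skip (c i)

theorem nil (c : ι → Data) : PT c fun _ => .nil :=
  of_polyBdd .nil ((PolyBdd.self _).add (.const _ 1)) fun i => ⟨_, .nil (c i), le_rfl⟩

theorem trans (h : PT c a) (h' : PT a b) : PT c b := by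
  have hb := h.polyBdd
  obtain ⟨p, q, h⟩ := h
  obtain ⟨p', q', h'⟩ := h'
  exact of_polyBdd (.seq p p') ((((PolyBdd.self _).eval q).add (hb.eval q')).add (.const _ 1))
    fun i => (h i).seq (h' i)

theorem pair (h : PT c a) (h' : PT c b) : PT c fun i => .cons (a i) (b i) := by
  obtain ⟨p, q, h⟩ := h
  obtain ⟨p', q', h'⟩ := h'
  exact of_polyBdd (.pair p p') (((((PolyBdd.self _).eval q).add ((PolyBdd.self _).eval q')).add
    (.self _)).add (.const _ 1)) fun i => (h i).pair (h' i)

theorem fst (h : PT c a) : PT c fun i => (a i).fst :=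
  h.trans (of_polyBdd .fst ((PolyBdd.self _).add (.const _ 1)) fun i => .fst (a i))

theorem snd (h : PT c a) : PT c fun i => (a i).snd :=
  h.trans (of_polyBdd .snd ((PolyBdd.self _).add (.const _ 1)) fun i => .snd (a i))

theorem reindex {κ : Type} (h : PT c a) (g : κ → ι) : PT (fun k => c (g k)) fun k => a (g k) :=
  let ⟨p, q, h⟩ := h; ⟨p, q, fun k => h (g k)⟩

theorem var {κ : Type} (a b : κ → Data) : PT (fun k => .cons (a k) (b k)) b :=
  (refl fun k => Data.cons (a k) (b k)).snd

/-- A value that is computed from the context is computed from every extension of the context. -/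
theorem weak {κ : Type} (h : PT c a) (g : κ → ι) (d : κ → Data) :
    PT (fun k => .cons (c (g k)) (d k)) fun k => a (g k) :=
  (refl fun k => Data.cons (c (g k)) (d k)).fst.trans (h.reindex g)

theorem congr (h : PT c a) (hab : ∀ i, a i = b i) : PT c b := by
  rwa [← funext hab]

theorem ite {P : ι → Prop} [∀ i, Decidable (P i)] (hP : PT c fun i => encBool (P i))
    (h : PT c a) (h' : PT c b) : PT c fun i => if P i then a i else b i := by
  obtain ⟨p₀, q₀, h₀⟩ := hP
  obtain ⟨p, q, h⟩ := h
  obtain ⟨p', q', h'⟩ := h'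
  refine of_polyBdd (.ite p₀ p p') ((((((PolyBdd.self _).eval q₀).add
    ((PolyBdd.self _).eval q)).add ((PolyBdd.self _).eval q')).add (.self _)).add (.const _ 1))
    fun i => ?_
  obtain ⟨t₀, h₀, b₀⟩ := h₀ i
  obtain ⟨t, h, b⟩ := h i
  obtain ⟨t', h', b'⟩ := h' i
  by_cases hi : P i
  · simp only [encBool, if_pos hi] at h₀
    rw [if_pos hi]
    exact ⟨_, .ite_true h₀ h, by omega⟩
  · simp only [encBool, if_neg hi] at h₀
    rw [if_neg hi]
    exact ⟨_, .ite_false h₀ h', by omega⟩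

/-- Iteration of a step over the elements of a list. -/
theorem fold {L : ι → List Data} {s : ι → ℕ → Data} (hL : PT c fun i => encList (L i))
    (h0 : PT c fun i => s i 0)
    (hs : PT (fun j : {p : ι × ℕ // p.2 < (L p.1).length} =>
        Data.cons (c j.1.1) (.cons ((L j.1.1)[j.1.2]'j.2) (s j.1.1 j.1.2)))
      fun j => s j.1.1 (j.1.2 + 1))
    (hb : ∃ q : Polynomial ℕ, ∀ i k, k ≤ (L i).length → (s i k).size ≤ q.eval (c i).size) :
    PT c fun i => s i (L i).length := by
  have hLb := hL.polyBdd
  have h0b := h0.polyBdd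
  obtain ⟨pL, qL, hL⟩ := hL
  obtain ⟨p0, q0, h0⟩ := h0
  obtain ⟨ps, qs, hs⟩ := hs
  obtain ⟨q, hb⟩ := hb
  have hel : ∀ (l : List Data) (k : ℕ) (hk : k < l.length),
      encList (l.drop k) = .cons l[k] (encList (l.drop (k + 1))) := by
    intro l k hk
    rw [List.drop_eq_getElem_cons hk]
    rfl
  have hdrop : ∀ (l : List Data) (k : ℕ), (encList (l.drop k)).size ≤ (encList l).size := by
    intro l
    induction l with
    | nil => simp
    | cons d l ih =>
      intro k
      cases k with
      | zero => simp
      | succ k =>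
        have := ih k
        simp only [List.drop_succ_cons, encList, List.foldr_cons, Data.size] at *
        omega
  have hlen : ∀ l : List Data, l.length ≤ (encList l).size := by
    intro l
    induction l with
    | nil => simp
    | cons d l ih =>
      have := d.size_pos
      simp only [List.length_cons, encList, List.foldr_cons, Data.size] at *
      omega
  -- `M` bounds the loop state: context, remaining list, accumulator, and two joining nodes. `K`
  -- bounds one round of the loop, including its test.
  let M : ι → ℕ := fun i => (c i).size + (encList (L i)).size + q.eval (c i).size + 2
  have hM : PolyBdd (fun i => (c i).size) M :=
    (((PolyBdd.self _).add hLb).add ((PolyBdd.self _).eval q)).add (.const _ 2)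
  let K : ι → ℕ := fun i => 30 * (M i + 1) + qs.eval (M i)
  have hK : PolyBdd (fun i => (c i).size) K :=
    ((PolyBdd.const _ 30).mul (hM.add (.const _ 1))).add (hM.eval qs)
  -- The body keeps the context, passes to the tail of the list, and runs the step program on
  -- context, head and accumulator.
  let body : Prog := .pair .fst (.pair (.seq .snd (.seq .fst .snd))
    (.seq (.pair .fst (.pair (.seq .snd (.seq .fst .fst)) (.seq .snd .snd))) ps))
  let st : ι → ℕ → Data := fun i k => .cons (c i) (.cons (encList ((L i).drop k)) (s i k))
  have hst : ∀ i k, k ≤ (L i).length → (st i k).size ≤ M i := by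
    intro i k hk
    have := hb i k hk
    have := hdrop (L i) k
    simp only [st, Data.size, M]
    omega
  -- The subtracted amount is reserved for the loop test and overhead. The summand `30 * (M i + 1)`
  -- of `K i` is large enough for the subtraction not to truncate.
  have hbody : ∀ i k, k < (L i).length → RunsLe body (st i k) (st i (k + 1)) (K i - 3 * M i - 20) := by
    intro i k hk
    have hx := hst i k hk.le
    have he := hel (L i) k hk
    have hd := hdrop (L i) k
    have e1 := RunsLe.fst (st i k)
    have e2 := RunsLe.snd (st i k)
    simp only [st, Data.fst, Data.snd] at e1 e2
    have e3 := RunsLe.fst (.cons (encList ((L i).drop k)) (s i k))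
    have e4 := RunsLe.snd (.cons (encList ((L i).drop k)) (s i k))
    simp only [Data.fst, Data.snd] at e3 e4
    have e5 := RunsLe.fst (encList ((L i).drop k))
    have e6 := RunsLe.snd (encList ((L i).drop k))
    have e7 := hs ⟨(i, k), hk⟩
    have hin : (Data.cons (c i) (.cons ((L i)[k]'hk) (s i k))).size ≤ M i := by
      simp only [st, Data.size] at hx ⊢
      rw [he] at hx
      simp only [Data.size] at hx
      omega
    have hq := eval_mono qs hin
    rw [he] at e5 e6
    simp only [Data.fst, Data.snd] at e5 e6
    rw [← he] at e5 e6
    refine RunsLe.mono (e1.pair ((e2.seq (e3.seq e6)).pair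
      ((e1.pair ((e2.seq (e3.seq e5)).pair (e2.seq e4))).seq e7))) ?_
    simp only [st, Data.size] at hx hq ⊢
    simp only [K]
    omega
  -- There are `m` rounds left, and one more `K i` pays for the final test.
  have hloop : ∀ i m k, k + m = (L i).length →
      RunsLe (.loop (.seq .snd .fst) body) (st i k) (st i (L i).length) ((m + 1) * K i) := by
    intro i m
    induction m with
    | zero =>
      intro k hk
      obtain rfl : k = (L i).length := by omega
      have hx := hst i _ le_rfl
      have hc := Runs.seq (.snd (st i (L i).length)) (.fst _)
      have : encList ((L i).drop (L i).length) = .nil := by simp [encList]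
      simp only [st, Data.snd, Data.fst, this] at hc
      refine ⟨_, Runs.loop_stop (by simpa only [st, this] using hc), ?_⟩
      simp only [st, Data.size, this] at hx ⊢
      simp only [K]
      omega
    | succ m ih =>
      intro k hk
      have hk' : k < (L i).length := by omega
      have hx := hst i k hk'.le
      have hc : Runs (.seq .snd .fst) (st i k) (encList ((L i).drop k)) _ :=
        .seq (.snd _) (.fst _)
      rw [hel (L i) k hk'] at hc
      obtain ⟨t, ht, htb⟩ := hbody i k hk'
      obtain ⟨r, hr, hrb⟩ := ih (k + 1) (by omega)
      refine ⟨_, .loop_step hc ht hr, ?_⟩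
      have : (m + 1 + 1) * K i = K i + (m + 1) * K i := by ring
      have hKM : 30 * (M i + 1) ≤ K i := by simp only [K]; omega
      simp only [st, Data.size, Data.snd] at hx ⊢
      omega
  refine of_polyBdd (.seq (.pair .skip (.pair pL p0))
      (.seq (.loop (.seq .snd .fst) body) (.seq .snd .snd)))
    (t := fun i => ((c i).size + 1 + (qL.eval (c i).size + q0.eval (c i).size + (c i).size + 1) +
      (c i).size + 1) + (((encList (L i)).size + 1) * K i + (M i + 1 + (M i + 1) + 1) + 1) + 1) ?_ ?_
  · have S := PolyBdd.self fun i => (c i).size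
    have one := PolyBdd.const (fun i => (c i).size) 1
    exact ((((S.add one).add (((((S.eval qL).add (S.eval q0)).add S).add one))).add S).add
      one).add ((((hLb.add one).mul hK).add (((hM.add one).add (hM.add one)).add one)).add
      one) |>.add one
  · intro i
    have h1 := (RunsLe.skip (c i)).pair ((hL i).pair (h0 i))
    have h2 := (hloop i (L i).length 0 (by omega)).mono
      (Nat.mul_le_mul_right (K i) (Nat.add_le_add_right (hlen (L i)) 1))
    have hx := hst i _ (le_refl (L i).length)
    have h3 := (RunsLe.snd (st i (L i).length)).mono (Nat.add_le_add_right hx 1)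
    have h4 := (RunsLe.snd (st i (L i).length).snd).mono
      (Nat.add_le_add_right ((Data.snd_size_le _).trans hx) 1)
    exact h1.seq (h2.seq (h3.seq h4))

end PT

open scoped Classical

/-! ### Lists, numbers, and vertices as data -/

theorem size_encList (l : List Data) :
    (encList l).size = (l.map fun d => d.size + 1).sum + 1 := by
  induction l with
  | nil => rfl
  | cons d l ih =>
    simp only [encList, List.foldr_cons, Data.size, List.map_cons, List.sum_cons] at *
    omega

theorem length_le_size (l : List Data) : l.length ≤ (encList l).size := by
  rw [size_encList]
  induction l with
  | nil => simp
  | cons d l ih => simp only [List.length_cons, List.map_cons, List.sum_cons]; omega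

theorem size_le_of_mem {l : List Data} {d : Data} (h : d ∈ l) : d.size ≤ (encList l).size := by
  rw [size_encList]
  have := List.single_le_sum (l := l.map fun d => d.size + 1) (by simp) (d.size + 1)
    (List.mem_map.2 ⟨d, h, rfl⟩)
  omega

theorem size_encList_le {l : List Data} {b : ℕ} (h : ∀ d ∈ l, d.size ≤ b) :
    (encList l).size ≤ l.length * (b + 1) + 1 := by
  rw [size_encList]
  have := List.sum_le_card_nsmul (l.map fun d => d.size + 1) (b + 1) (by simpa using h)
  simpa using this

theorem size_encNat (k : ℕ) : (encNat k).size = 2 * k + 1 := by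
  simp [encNat, size_encList, Data.size, mul_comm]

theorem size_encBool_le (P : Prop) : (encBool P).size ≤ 3 := by
  unfold encBool
  split <;> simp [Data.size]

theorem size_encSet_le {n : ℕ} (S : Finset (Fin n)) : (encSet S).size ≤ n * 4 + 1 := by
  refine (size_encList_le (b := 3) ?_).trans (by simp)
  simp only [List.mem_ofFn, forall_exists_index]
  rintro _ i rfl
  exact size_encBool_le _

theorem size_encMap_le {n : ℕ} (f : Fin n → Fin n) :
    (encMap f).size ≤ n * (2 * n + 1 + 1) + 1 := by
  refine (size_encList_le (b := 2 * n + 1) ?_).trans (by simp)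
  simp only [List.mem_ofFn, forall_exists_index]
  rintro _ i rfl
  rw [size_encNat]
  omega

theorem le_size_encNat (n : ℕ) : n ≤ (encNat n).size := by
  rw [size_encNat]
  omega

/-! ### Logic, lists, unary numbers and bounded quantifiers in polynomial time -/

namespace PT

variable {ι : Type} {c : ι → Data}

theorem bool_const (P : Prop) : PT c fun _ => encBool P := by
  by_cases h : P
  · exact (nil c |>.pair (nil c)).congr fun _ => by simp [encBool, h]
  · exact (nil c).congr fun _ => by simp [encBool, h]

theorem iteBool {P Q R : ι → Prop} (hP : PT c fun i => encBool (P i))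
    (hQ : PT c fun i => encBool (Q i)) (hR : PT c fun i => encBool (R i)) :
    PT c fun i => encBool ((P i → Q i) ∧ (¬P i → R i)) :=
  (hP.ite hQ hR).congr fun i => by by_cases h : P i <;> simp [h]

theorem and {P Q : ι → Prop} (hP : PT c fun i => encBool (P i))
    (hQ : PT c fun i => encBool (Q i)) : PT c fun i => encBool (P i ∧ Q i) :=
  (hP.iteBool hQ (bool_const False)).congr fun i => by congr 1; apply propext; tauto

theorem or {P Q : ι → Prop} (hP : PT c fun i => encBool (P i))
    (hQ : PT c fun i => encBool (Q i)) : PT c fun i => encBool (P i ∨ Q i) :=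
  (hP.iteBool (bool_const True) hQ).congr fun i => by congr 1; apply propext; tauto

theorem not {P : ι → Prop} (hP : PT c fun i => encBool (P i)) :
    PT c fun i => encBool (¬P i) :=
  (hP.iteBool (bool_const False) (bool_const True)).congr fun i => by
    congr 1; apply propext; tauto

theorem isNil {a : ι → Data} (ha : PT c a) : PT c fun i => encBool (a i = .nil) := by
  obtain ⟨p, q, h⟩ := ha
  have S := PolyBdd.self fun i => (c i).size
  have one := PolyBdd.const (fun i => (c i).size) 1
  refine of_polyBdd (.ite p .nil (.pair .nil .nil))
    ((S.eval q).add (((((S.add one).add (S.add one)).add S).add one).add (S.add one))) fun i => ?_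
  obtain ⟨t, h, b⟩ := h i
  cases hd : a i with
  | nil =>
    rw [hd] at h
    simp only [encBool, if_true]
    exact ⟨_, .ite_false h (.pair (.nil _) (.nil _)), by omega⟩
  | cons x y =>
    rw [hd] at h
    simp only [encBool, reduceCtorEq, if_false]
    exact ⟨_, .ite_true h (.nil _), by omega⟩

/-- Iteration builds lists by prepending, which reverses them; this restores the order. -/
theorem reverse {L : ι → List Data} (hL : PT c fun i => encList (L i)) :
    PT c fun i => encList (L i).reverse := by
  have h := hL.fold (s := fun i k => encList ((L i).take k).reverse) ?_ ?_ ?_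
  · exact h.congr fun i => by simp
  · exact (nil c).congr fun i => by simp [encList]
  · refine ((var _ _).fst.pair (var _ _).snd).congr fun j => ?_
    simp only [Data.fst, Data.snd]
    rw [List.take_succ_eq_append_getElem j.2]
    simp only [encList, List.reverse_append, List.reverse_singleton, List.singleton_append,
      List.foldr_cons]
  · obtain ⟨q, hq⟩ := hL.polyBdd
    refine ⟨q, fun i k _ => le_trans ?_ (hq i)⟩
    simp only [size_encList, List.map_reverse, List.sum_reverse]
    gcongr
    exact ((List.take_sublist k (L i)).map _).sum_le_sum (by simp)

section

variable {β : ι → Type} {e : ∀ i, β i → Data} {L : ∀ i, List (β i)}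

theorem filterMap (P : ∀ i, β i → Prop) [∀ i, DecidablePred (P i)] (f : ∀ i, β i → Data)
    (hL : PT c fun i => encList ((L i).map (e i)))
    (hP : PT (fun j : Σ i, β i => .cons (c j.1) (e j.1 j.2)) fun j => encBool (P j.1 j.2))
    (hf : PT (fun j : Σ i, β i => .cons (c j.1) (e j.1 j.2)) fun j => f j.1 j.2) :
    PT c fun i => encList (((L i).filter (P i ·)).map (f i)) := by
  suffices PT c fun i => encList (((L i).filter (P i ·)).map (f i)).reverse from
    this.reverse.congr fun i => by simp
  have h := hL.fold
    (s := fun i k => encList ((((L i).take k).filter (P i ·)).map (f i)).reverse) ?_ ?_ ?_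
  · exact h.congr fun i => by simp
  · exact (nil c).congr fun i => by simp [encList]
  · let g (j : {p : ι × ℕ // p.2 < ((L p.1).map (e p.1)).length}) : Σ i, β i :=
      ⟨j.1.1, (L j.1.1)[j.1.2]'(by simpa using j.2)⟩
    have hc : PT (fun j : {p : ι × ℕ // p.2 < ((L p.1).map (e p.1)).length} =>
        Data.cons (c j.1.1) (.cons (((L j.1.1).map (e j.1.1))[j.1.2]'j.2)
          (encList ((((L j.1.1).take j.1.2).filter (P j.1.1 ·)).map (f j.1.1)).reverse)))
        fun j => .cons (c (g j).1) (e (g j).1 (g j).2) :=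
      ((refl _).fst.pair (refl _).snd.fst).congr fun j => by simp [g, Data.fst, Data.snd]
    refine (ite (hc.trans (hP.reindex g)) ((hc.trans (hf.reindex g)).pair (refl _).snd.snd)
      (refl _).snd.snd).congr fun j => ?_
    have hj : j.1.2 < (L j.1.1).length := by simpa using j.2
    rw [List.take_succ_eq_append_getElem hj]
    simp only [g, Data.snd, List.filter_append]
    split <;> rename_i hPj <;> simp [encList, hPj]
  · obtain ⟨q, hq⟩ := hf.polyBdd
    obtain ⟨r, hr⟩ := hL.polyBdd
    obtain ⟨u, hu⟩ := (((PolyBdd.self fun i => (c i).size).eval r).mul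
      (((((PolyBdd.self _).add ((PolyBdd.self _).eval r)).add (.const _ 1)).eval q).add
        (.const _ 1))).add (.const _ 1)
    refine ⟨u, fun i k _ => le_trans (le_trans (size_encList_le
      (b := q.eval ((c i).size + r.eval (c i).size + 1)) ?_) ?_) (hu i)⟩
    · simp only [List.mem_reverse, List.mem_map, List.mem_filter, forall_exists_index, and_imp]
      rintro _ b hb - rfl
      refine (hq ⟨i, b⟩).trans (eval_mono q ?_)
      have := size_le_of_mem (List.mem_map.2 ⟨b, List.mem_of_mem_take hb, rfl⟩ :
        e i b ∈ (L i).map (e i))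
      have : (encList ((L i).map (e i))).size ≤ r.eval (c i).size := hr i
      simp only [Data.size]
      omega
    · refine Nat.add_le_add_right (Nat.mul_le_mul_right _ ?_) 1
      have h1 := length_le_size ((L i).map (e i))
      have h2 := List.length_filter_le (P i ·) ((L i).take k)
      have : (encList ((L i).map (e i))).size ≤ r.eval (c i).size := hr i
      simp only [List.length_reverse, List.length_map, List.length_take] at *
      omega

/-- The size bound is required of every state of the type `S i`, reachable or not. It then follows
from the type alone, as for subsets of the vertices or maps on them. -/
theorem foldl {S : ι → Type} (eS : ∀ i, S i → Data) (s₀ : ∀ i, S i) (F : ∀ i, S i → β i → S i)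
    (hL : PT c fun i => encList ((L i).map (e i)))
    (h0 : PT c fun i => eS i (s₀ i))
    (hs : PT (fun j : Σ i, S i × β i => .cons (c j.1) (.cons (e j.1 j.2.2) (eS j.1 j.2.1)))
      fun j => eS j.1 (F j.1 j.2.1 j.2.2))
    (hb : ∃ q : Polynomial ℕ, ∀ i s, (eS i s).size ≤ q.eval (c i).size) :
    PT c fun i => eS i ((L i).foldl (F i) (s₀ i)) := by
  have h := hL.fold (s := fun i k => eS i (((L i).take k).foldl (F i) (s₀ i))) ?_ ?_ ?_
  · exact h.congr fun i => by simp
  · exact h0.congr fun i => by simp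
  · let g (j : {p : ι × ℕ // p.2 < ((L p.1).map (e p.1)).length}) : Σ i, S i × β i :=
      ⟨j.1.1, ((L j.1.1).take j.1.2).foldl (F j.1.1) (s₀ j.1.1),
        (L j.1.1)[j.1.2]'(by simpa using j.2)⟩
    refine ((refl _).trans ?_).congr (a := fun j => eS (g j).1 (F (g j).1 (g j).2.1 (g j).2.2)) ?_
    · have := hs.reindex g
      simpa only [g, List.getElem_map] using this
    · intro j
      have hj : j.1.2 < (L j.1.1).length := by simpa using j.2
      dsimp only [g]
      rw [List.take_succ_eq_append_getElem hj, List.foldl_append]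
      rfl
  · obtain ⟨q, hq⟩ := hb
    exact ⟨q, fun i k _ => hq i _⟩

end

theorem drop {a : ι → ℕ} {L : ι → List Data} (ha : PT c fun i => encNat (a i))
    (hL : PT c fun i => encList (L i)) : PT c fun i => encList ((L i).drop (a i)) := by
  have h := ha.fold (L := fun i => List.replicate (a i) .nil)
    (s := fun i k => encList ((L i).drop k)) ?_ ?_ ?_
  · exact h.congr fun i => by simp
  · exact hL.congr fun i => by simp
  · refine (refl _).snd.snd.snd.congr fun j => ?_
    simp only [Data.snd]
    rw [← List.tail_drop]
    cases (L j.1.1).drop j.1.2 <;> rfl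
  · obtain ⟨q, hq⟩ := hL.polyBdd
    refine ⟨q, fun i k _ => le_trans ?_ (hq i)⟩
    simp only [size_encList]
    gcongr
    exact ((List.drop_sublist k (L i)).map _).sum_le_sum (by simp)

/-- Dropping entries from a unary number is truncated subtraction, and two numbers are equal iff
both truncated differences vanish. -/
theorem natEq {a b : ι → ℕ} (ha : PT c fun i => encNat (a i)) (hb : PT c fun i => encNat (b i)) :
    PT c fun i => encBool (a i = b i) := by
  refine ((drop ha hb).isNil.and (drop hb ha).isNil).congr fun i => ?_
  have key : ∀ k : ℕ, encNat k = .nil ↔ k = 0 := by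
    intro k
    cases k <;> simp [encNat, encList, List.replicate_succ]
  have h : ∀ k l : ℕ, encList ((List.replicate k Data.nil).drop l) = encNat (k - l) := by
    intro k l
    simp [encNat]
  congr 1
  rw [h, h, key, key]
  apply propext
  omega

section

variable {n : ι → ℕ}

theorem lookup {f : ∀ i, Fin (n i) → Data} {j : ∀ i, Fin (n i)}
    (hf : PT c fun i => encList (List.ofFn (f i))) (hj : PT c fun i => encNat (j i)) :
    PT c fun i => f i (j i) := by
  refine (drop hj hf).fst.congr fun i => ?_
  rw [List.drop_eq_getElem_cons (by simp)]
  simp [encList, Data.fst]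

theorem mem {S : ∀ i, Finset (Fin (n i))} {j : ∀ i, Fin (n i)}
    (hS : PT c fun i => encSet (S i)) (hj : PT c fun i => encNat (j i)) :
    PT c fun i => encBool (j i ∈ S i) :=
  lookup (f := fun i j => encBool (j ∈ S i)) hS hj

theorem app {f : ∀ i, Fin (n i) → Fin (n i)} {j : ∀ i, Fin (n i)}
    (hf : PT c fun i => encMap (f i)) (hj : PT c fun i => encNat (j i)) :
    PT c fun i => encNat (f i (j i)) :=
  lookup (f := fun i j => encNat (f i j)) hf hj

theorem weakV {a : ι → Data} (h : PT c a) :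
    PT (fun k : Σ i, Fin (n i) => .cons (c k.1) (encNat k.2)) fun k => a k.1 :=
  h.weak _ _

theorem finEq {a b : ∀ i, Fin (n i)} (ha : PT c fun i => encNat (a i))
    (hb : PT c fun i => encNat (b i)) : PT c fun i => encBool (a i = b i) :=
  (natEq ha hb).congr fun i => by simp only [Fin.ext_iff]

theorem range (hn : PT c fun i => encNat (n i)) :
    PT c fun i => encList ((List.finRange (n i)).map fun j : Fin (n i) => encNat j) := by
  -- The unary number itself drives the iteration. Its entries are all leaves, so the state has to
  -- carry the current index.
  have h := hn.fold (L := fun i => List.replicate (n i) .nil)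
    (s := fun _ k => .cons (encNat k) (encList ((List.range k).map encNat).reverse)) ?_ ?_ ?_
  · refine h.snd.reverse.congr fun i => ?_
    simp only [List.length_replicate, List.reverse_reverse]
    rw [← List.map_coe_finRange_eq_range, List.map_map]
    simp [Function.comp_def]
  · exact ((nil c).pair (nil c)).congr fun i => by simp [encList, encNat]
  · refine (((nil _).pair (refl _).snd.snd.fst).pair (refl _).snd.snd).congr fun j => ?_
    simp [Data.fst, Data.snd, encNat, List.range_succ, encList, List.replicate_succ]
  · obtain ⟨q, hq⟩ := ((hn.polyBdd.add ((hn.polyBdd.mul (hn.polyBdd.add (.const _ 1))).add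
      (.const _ 1))).add (.const _ 1))
    refine ⟨q, fun i k hk => le_trans ?_ (hq i)⟩
    simp only [List.length_replicate] at hk
    have h1 := size_encNat k
    have h2 := size_encNat (n i)
    have h3 : (encList ((List.range k).map encNat).reverse).size ≤
        k * ((encNat (n i)).size + 1) + 1 := by
      refine (size_encList_le (b := (encNat (n i)).size) ?_).trans (by simp)
      simp only [List.mem_reverse, List.mem_map, List.mem_range, forall_exists_index, and_imp]
      rintro _ l hl rfl
      rw [size_encNat, size_encNat]
      omega
    have h4 := Nat.mul_le_mul_right ((encNat (n i)).size + 1) (hk.trans (le_size_encNat _))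
    simp only [Data.size]
    omega

theorem tabulate {f : ∀ i, Fin (n i) → Data} (hn : PT c fun i => encNat (n i))
    (hf : PT (fun j : Σ i, Fin (n i) => .cons (c j.1) (encNat j.2)) fun j => f j.1 j.2) :
    PT c fun i => encList (List.ofFn (f i)) :=
  (filterMap (e := fun i (j : Fin (n i)) => encNat j) (fun _ _ => True) f (range hn) (bool_const True) hf).congr fun i => by
    simp [List.ofFn_eq_map]

theorem filter {P : ∀ i, Fin (n i) → Prop} (hn : PT c fun i => encNat (n i))
    (hP : PT (fun j : Σ i, Fin (n i) => .cons (c j.1) (encNat j.2)) fun j =>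
      encBool (P j.1 j.2)) :
    PT c fun i => encSet (Finset.univ.filter (P i)) :=
  (tabulate (f := fun i j => encBool (P i j)) hn hP).congr fun i => by simp [encSet]

theorem foldV {S : ι → Type} (eS : ∀ i, S i → Data) (s₀ : ∀ i, S i)
    (F : ∀ i, S i → Fin (n i) → S i) (hn : PT c fun i => encNat (n i))
    (h0 : PT c fun i => eS i (s₀ i))
    (hs : PT (fun j : Σ i, S i × Fin (n i) =>
      .cons (c j.1) (.cons (encNat j.2.2) (eS j.1 j.2.1))) fun j => eS j.1 (F j.1 j.2.1 j.2.2))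
    (hb : PolyBdd (fun j : Σ i, S i => (c j.1).size) fun j => (eS j.1 j.2).size) :
    PT c fun i => eS i ((List.finRange (n i)).foldl (F i) (s₀ i)) :=
  foldl (e := fun i (j : Fin (n i)) => encNat j) eS s₀ F (range hn) h0 hs (let ⟨q, hq⟩ := hb; ⟨q, fun i s => hq ⟨i, s⟩⟩)

theorem ex {P : ∀ i, Fin (n i) → Prop} (hn : PT c fun i => encNat (n i))
    (hP : PT (fun j : Σ i, Fin (n i) => .cons (c j.1) (encNat j.2)) fun j =>
      encBool (P j.1 j.2)) :
    PT c fun i => encBool (∃ j, P i j) := by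
  refine (filterMap (e := fun i (j : Fin (n i)) => encNat j) P (fun _ _ => .nil) (range hn) hP (nil _)).isNil.not.congr fun i => ?_
  congr 1
  have key : ∀ l : List Data, encList l = .nil ↔ l = [] := by
    rintro (_ | ⟨d, l⟩) <;> simp [encList]
  simp [key]

theorem all {P : ∀ i, Fin (n i) → Prop} (hn : PT c fun i => encNat (n i))
    (hP : PT (fun j : Σ i, Fin (n i) => .cons (c j.1) (encNat j.2)) fun j =>
      encBool (P j.1 j.2)) :
    PT c fun i => encBool (∀ j, P i j) :=
  (ex (P := fun i j => ¬P i j) hn hP.not).not.congr fun i => by simp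

end

end PT

/-- Some vertex with property `P`, or `d` if there is none. -/
noncomputable def pick {n : ℕ} (P : Fin n → Prop) (d : Fin n) : Fin n :=
  (List.finRange n).foldl (fun s j => if P j then j else s) d

theorem pick_spec {n : ℕ} {P : Fin n → Prop} (d : Fin n) (h : ∃ j, P j) : P (pick P d) := by
  have key : ∀ (l : List (Fin n)) (d : Fin n), (P d ∨ ∃ j ∈ l, P j) →
      P (l.foldl (fun s j => if P j then j else s) d) := by
    intro l
    induction l with
    | nil => simp
    | cons a l ih =>
      intro d hd
      simp only [List.foldl_cons]
      apply ih
      simp only [List.mem_cons, exists_eq_or_imp] at hd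
      by_cases ha : P a
      · simp [ha]
      · simpa [ha] using hd
  exact key _ d (Or.inr (by simpa using h))

theorem PT.pick {ι : Type} {c : ι → Data} {n : ι → ℕ} {P : ∀ i, Fin (n i) → Prop}
    {d : ∀ i, Fin (n i)} (hn : PT c fun i => encNat (n i))
    (hP : PT (fun j : Σ i, Fin (n i) => .cons (c j.1) (encNat j.2)) fun j => encBool (P j.1 j.2))
    (hd : PT c fun i => encNat (d i)) : PT c fun i => encNat (pick (P i) (d i)) := by
  refine foldV (fun i (j : Fin (n i)) => encNat j) d (fun i s j => if P i j then j else s)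
    hn hd ?_ ?_
  · let g (j : Σ i, Fin (n i) × Fin (n i)) : Σ i, Fin (n i) := ⟨j.1, j.2.2⟩
    have hc : PT (fun j : Σ i, Fin (n i) × Fin (n i) =>
        Data.cons (c j.1) (.cons (encNat j.2.2) (encNat j.2.1)))
        fun j => .cons (c (g j).1) (encNat (g j).2) :=
      (refl _).fst.pair (refl _).snd.fst
    refine ((hc.trans (hP.reindex g)).ite (refl _).snd.fst (refl _).snd.snd).congr fun j => ?_
    simp only [g, Data.fst, Data.snd]
    split <;> rfl
  · refine (hn.polyBdd.reindex Sigma.fst).mono fun j => ?_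
    rw [size_encNat, size_encNat]
    omega

/-! ### The algorithms -/

section Algorithms

variable {n : ℕ} (G : SimpleGraph (Fin n))

/-- The subgraph induced by `S`, with its vertices renumbered. -/
noncomputable def sub (S : Finset (Fin n)) : FinGraph :=
  ⟨((List.finRange n).filter (· ∈ S)).length, G.comap ((List.finRange n).filter (· ∈ S)).get⟩

/-- The minimum vertex cover number of the subgraph induced by `S`. -/
noncomputable def mu (S : Finset (Fin n)) : ℕ := mvc (sub G S).2

/-- One round of the search for the vertices of `U` that are connected to `T` inside `U`. -/
noncomputable def connStep (U T R : Finset (Fin n)) : Finset (Fin n) :=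
  Finset.univ.filter fun w => w ∈ R ∨ w ∈ U ∧ (w ∈ T ∨ ∃ w', w' ∈ R ∧ G.Adj w w')

/-- The vertices of `U` that are connected to `T` inside `U`. -/
noncomputable def connSet (U T : Finset (Fin n)) : Finset (Fin n) :=
  (List.finRange n).foldl (fun R _ => connStep G U T R) ∅

/-- The set of all cut vertices. -/
noncomputable def cutSet : Finset (Fin n) := Finset.univ.filter (IsCutVertex G)

/-- Greedy extension of `Y` by vertices in `P`, as long as it is contained in a minimum vertex
cover. -/
noncomputable def pass (P Y : Finset (Fin n)) : Finset (Fin n) :=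
  (List.finRange n).foldl
    (fun Y w => if w ∈ P ∧ mu G (insert w Y)ᶜ ≠ mu G Yᶜ then insert w Y else Y) Y

/-- A minimum vertex cover that contains `X` if possible and then as much of `S` as possible. -/
noncomputable def greedyCover (X S : Finset (Fin n)) : Finset (Fin n) :=
  pass G Finset.univ (pass G S (pass G X ∅))

/-- Each vertex that is not isolated is in a minimum vertex cover with all cut vertices. -/
def Extendable : Prop :=
  ∀ v, (∃ w, G.Adj v w) → ∀ x, x = v ∨ x ∈ cutSet G →
    x ∈ greedyCover G (insert v (cutSet G)) ∅

/-- `S` with one further vertex, if there is one. -/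
noncomputable def addOne (S : Finset (Fin n)) : Finset (Fin n) :=
  (List.finRange n).foldl (fun Q w => if ∀ x, x ∈ Q → x ∈ S then insert w Q else Q) S

/-- The initial configuration. -/
noncomputable def startConf : Finset (Fin n) :=
  if Extendable G then greedyCover G (cutSet G) ∅ else addOne (greedyCover G (cutSet G) ∅)

/-- The data of a partially traced path: unvisited vertices, guard movements, current vertex. -/
abbrev PathState (n : ℕ) : Type := Finset (Fin n) × (Fin n → Fin n) × Fin n

/-- The next vertex of a path to `T` in `U` from `w`. -/
noncomputable def nextVertex (T U : Finset (Fin n)) (w : Fin n) : Fin n :=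
  pick (fun w' => G.Adj w w' ∧ w' ∈ connSet G (U.erase w) T) w

/-- One step of a path to `T`; the guard on the new vertex moves to the previous one. -/
noncomputable def pathStep (T : Finset (Fin n)) (s : PathState n) : PathState n :=
  if s.2.2 ∈ T then s else
    (s.1.erase s.2.2, Function.update s.2.1 (nextVertex G T s.1 s.2.2) s.2.2,
      nextVertex G T s.1 s.2.2)

/-- Guard movements along a path in `S` that leads from `a` to `T`, after the guard on `a` has
moved to `b`. -/
noncomputable def path (S T : Finset (Fin n)) (a b : Fin n) : PathState n :=
  (List.finRange n).foldl (fun s _ => pathStep G T s) (S, Function.update id a b, a)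

/-- A partner of `z` in a maximum matching of the bipartite graph induced by `R`. -/
noncomputable def partner (R : Finset (Fin n)) (z : Fin n) : Fin n :=
  pick (fun y => y ∈ R ∧ G.Adj z y ∧ mu G ((R.erase z).erase y) = mu G (R.erase z)) z

/-- The guard on `z` moves to the partner of `z`, if `z` is in `S` and `R`. -/
noncomputable def matchStep (S : Finset (Fin n)) (s : Finset (Fin n) × (Fin n → Fin n))
    (z : Fin n) : Finset (Fin n) × (Fin n → Fin n) :=
  if z ∈ S ∧ z ∈ s.1 then
    ((s.1.erase z).erase (partner G s.1 z), Function.update s.2 z (partner G s.1 z))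
  else s

/-- The vertices that are matched after a path from `S \ S'` has been used. -/
noncomputable def rest (S S' : Finset (Fin n)) (x b : Fin n) : Finset (Fin n) :=
  Finset.univ.filter fun w => (w ∈ S ∧ w ∉ S' ∨ w ∈ S' ∧ w ∉ S) ∧ w ≠ x ∧ w ≠ b

/-- Guard movements from `S` to `S'` in which the guard on `a` moves to `b`. -/
noncomputable def shift (S S' : Finset (Fin n)) (a b : Fin n) : Fin n → Fin n :=
  ((List.finRange n).foldl (matchStep G S)
    (rest S S' (path G S (S \ S') a b).2.2 b, (path G S (S \ S') a b).2.1)).2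

/-- The configuration to which the guards move from `S` when the vertex `b` needs a guard. -/
noncomputable def target (S : Finset (Fin n)) (b : Fin n) : Finset (Fin n) :=
  if Extendable G then greedyCover G (insert b (cutSet G)) S
  else insert b (greedyCover G (cutSet G) ∅)

/-- The answer to an attack on the edge `uv`. -/
noncomputable def answer (S : Finset (Fin n)) (u v : Fin n) : Fin n → Fin n :=
  if u ∈ S then
    if v ∈ S then Function.update (Function.update id u v) v u else shift G S (target G S v) u v
  else shift G S (target G S u) v u

end Algorithms

/-- The encoded subgraph is the adjacency matrix with rows and columns deleted, so a program need
not carry out the renumbering. -/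
theorem encGraph_comap_get {n : ℕ} (G : SimpleGraph (Fin n)) (l : List (Fin n)) :
    encGraph ⟨l.length, G.comap l.get⟩ =
      encList (l.map fun j => encList (l.map fun k => encBool (G.Adj j k))) := by
  have h : ∀ f : Fin n → Data, l.map f = List.ofFn (fun k => f (l.get k)) := by
    intro f
    conv_lhs => rw [← List.ofFn_get l, List.map_ofFn]
    rfl
  simp only [h]
  rfl

/-! ### The algorithms run in polynomial time -/

namespace PT

variable {ι : Type} {c : ι → Data} {n : ι → ℕ}

section Sets

variable {S T : ∀ i, Finset (Fin (n i))} {j : ∀ i, Fin (n i)}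

theorem set {P : ∀ i, Fin (n i) → Prop} (hn : PT c fun i => encNat (n i))
    (hP : PT (fun j : Σ i, Fin (n i) => .cons (c j.1) (encNat j.2)) fun j => encBool (P j.1 j.2))
    (h : ∀ i j, j ∈ S i ↔ P i j) : PT c fun i => encSet (S i) :=
  (filter hn hP).congr fun i => by
    congr 1
    ext j
    simp [h]

theorem empty (hn : PT c fun i => encNat (n i)) :
    PT c fun i => encSet (∅ : Finset (Fin (n i))) :=
  set (P := fun _ _ => False) hn (bool_const False) (by simp)

theorem univ (hn : PT c fun i => encNat (n i)) :
    PT c fun i => encSet (Finset.univ : Finset (Fin (n i))) :=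
  set (P := fun _ _ => True) hn (bool_const True) (by simp)

theorem insert (hn : PT c fun i => encNat (n i)) (hS : PT c fun i => encSet (S i))
    (hj : PT c fun i => encNat (j i)) : PT c fun i => encSet (insert (j i) (S i)) :=
  set (P := fun i k => k = j i ∨ k ∈ S i) hn
    ((finEq (var _ _) (hj.weak _ _)).or (mem (hS.weak _ _) (var _ _))) (by simp)

theorem erase (hn : PT c fun i => encNat (n i)) (hS : PT c fun i => encSet (S i))
    (hj : PT c fun i => encNat (j i)) : PT c fun i => encSet ((S i).erase (j i)) :=
  set (P := fun i k => k ≠ j i ∧ k ∈ S i) hn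
    ((finEq (var _ _) (hj.weak _ _)).not.and (mem (hS.weak _ _) (var _ _))) (by simp)

theorem compl (hn : PT c fun i => encNat (n i)) (hS : PT c fun i => encSet (S i)) :
    PT c fun i => encSet (S i)ᶜ :=
  set (P := fun i k => k ∉ S i) hn (mem (hS.weak _ _) (var _ _)).not (by simp)

theorem sdiff (hn : PT c fun i => encNat (n i)) (hS : PT c fun i => encSet (S i))
    (hT : PT c fun i => encSet (T i)) : PT c fun i => encSet (S i \ T i) :=
  set (P := fun i k => k ∈ S i ∧ k ∉ T i) hn
    ((mem (hS.weak _ _) (var _ _)).and (mem (hT.weak _ _) (var _ _)).not) (by simp)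

theorem update {f : ∀ i, Fin (n i) → Fin (n i)} {k : ∀ i, Fin (n i)}
    (hn : PT c fun i => encNat (n i)) (hf : PT c fun i => encMap (f i))
    (hj : PT c fun i => encNat (j i)) (hk : PT c fun i => encNat (k i)) :
    PT c fun i => encMap (Function.update (f i) (j i) (k i)) := by
  refine tabulate hn ?_
  refine ((finEq (var _ _) (hj.weak Sigma.fst _)).ite (hk.weak _ _)
    (app (hf.weak _ _) (var _ _))).congr fun p => ?_
  simp only [Function.update_apply]
  split <;> rfl

theorem mapId (hn : PT c fun i => encNat (n i)) :
    PT c fun i => encMap (id : Fin (n i) → Fin (n i)) :=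
  tabulate hn (var _ _)

theorem rest {x b : ∀ i, Fin (n i)} (hn : PT c fun i => encNat (n i))
    (hS : PT c fun i => encSet (S i)) (hT : PT c fun i => encSet (T i))
    (hx : PT c fun i => encNat (x i)) (hb : PT c fun i => encNat (b i)) :
    PT c fun i => encSet (rest (S i) (T i) (x i) (b i)) := by
  have h1 := mem (hS.weak Sigma.fst _) (var _ fun j : Σ i, Fin (n i) => encNat j.2)
  have h2 := mem (hT.weak Sigma.fst _) (var _ fun j : Σ i, Fin (n i) => encNat j.2)
  exact set (P := fun i w => (w ∈ S i ∧ w ∉ T i ∨ w ∈ T i ∧ w ∉ S i) ∧ w ≠ x i ∧ w ≠ b i) hn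
    (((h1.and h2.not).or (h2.and h1.not)).and
    ((finEq (var _ _) (hx.weak _ _)).not.and (finEq (var _ _) (hb.weak _ _)).not))
    (by simp [EternalVC.rest])

theorem iteSet {P : ι → Prop} [∀ i, Decidable (P i)] (hP : PT c fun i => encBool (P i))
    (hS : PT c fun i => encSet (S i)) (hT : PT c fun i => encSet (T i)) :
    PT c fun i => encSet (if P i then S i else T i) :=
  (hP.ite hS hT).congr fun i => by split <;> rfl

theorem foldSet (s₀ : ∀ i, Finset (Fin (n i)))
    (F : ∀ i, Finset (Fin (n i)) → Fin (n i) → Finset (Fin (n i)))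
    (hn : PT c fun i => encNat (n i)) (h0 : PT c fun i => encSet (s₀ i))
    (hs : PT (fun j : Σ i, Finset (Fin (n i)) × Fin (n i) =>
      .cons (c j.1) (.cons (encNat j.2.2) (encSet j.2.1))) fun j =>
        encSet (F j.1 j.2.1 j.2.2)) :
    PT c fun i => encSet ((List.finRange (n i)).foldl (F i) (s₀ i)) := by
  refine foldV (fun i (S : Finset (Fin (n i))) => encSet S) s₀ F hn h0 hs ?_
  have h := hn.polyBdd.reindex (fun j : Σ i, Finset (Fin (n i)) => j.1)
  refine ((h.mul (.const _ 4)).add (.const _ 1)).mono fun j => ?_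
  refine (size_encSet_le j.2).trans ?_
  have := le_size_encNat (n j.1)
  gcongr

theorem addOne (hn : PT c fun i => encNat (n i)) (hS : PT c fun i => encSet (S i)) :
    PT c fun i => encSet (addOne (S i)) := by
  refine foldSet _ _ hn hS (iteSet (all (hn.weak _ _) ?_)
    (insert (hn.weak _ _) (var _ _).snd (var _ _).fst) (var _ _).snd)
  have h1 := mem (j := fun j : Σ k : Σ i, Finset (Fin (n i)) × Fin (n i), Fin (n k.1) => j.2)
    (((var (fun k : Σ i, Finset (Fin (n i)) × Fin (n i) => c k.1)
      (fun k => .cons (encNat k.2.2) (encSet k.2.1))).snd).weak Sigma.fst _) (var _ _)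
  have h2 := mem (j := fun j : Σ k : Σ i, Finset (Fin (n i)) × Fin (n i), Fin (n k.1) => j.2)
    ((hS.weak (fun k : Σ i, Finset (Fin (n i)) × Fin (n i) => k.1)
      (fun k => .cons (encNat k.2.2) (encSet k.2.1))).weak Sigma.fst _) (var _ _)
  exact (h1.not.or h2).congr fun j => by
    congr 1
    exact propext imp_iff_not_or.symm

end Sets

section Graphs

variable {G : ∀ i, SimpleGraph (Fin (n i))} {S T U : ∀ i, Finset (Fin (n i))}
  {a b : ∀ i, Fin (n i)} (hG : PT c fun i => encGraph ⟨n i, G i⟩)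
include hG

/-- The number of vertices is read off the matrix by replacing each row with a leaf. -/
theorem order : PT c fun i => encNat (n i) := by
  refine (filterMap (β := fun i => Fin (n i))
    (e := fun i j => encList (List.ofFn fun k : Fin (n i) => encBool ((G i).Adj j k)))
    (L := fun i => List.finRange (n i)) (fun _ _ => True) (fun _ _ => .nil) ?_ (bool_const True)
    (nil _)).congr fun i => ?_
  · exact hG.congr fun i => by simp only [encGraph, List.ofFn_eq_map]
  · simp [encNat]

theorem adj (ha : PT c fun i => encNat (a i)) (hb : PT c fun i => encNat (b i)) :
    PT c fun i => encBool ((G i).Adj (a i) (b i)) :=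
  lookup (f := fun i k => encBool ((G i).Adj (a i) k))
    (lookup (f := fun i j => encList (List.ofFn fun k => encBool ((G i).Adj j k))) hG ha) hb

theorem adj₂ : PT (fun k : Σ p : Σ i, Fin (n i), Fin (n p.1) =>
      .cons (.cons (c k.1.1) (encNat k.1.2)) (encNat k.2))
    fun k => encBool ((G k.1.1).Adj k.1.2 k.2) := by
  exact adj (n := fun k : Σ p : Σ i, Fin (n i), Fin (n p.1) => n k.1.1)
    (G := fun k => G k.1.1) (a := fun k => k.1.2) (b := fun k => k.2) hG.weakV.weakV
    (var (fun p : Σ i, Fin (n i) => c p.1) fun p => encNat p.2).weakV (var _ _)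

theorem connStep {R : ∀ i, Finset (Fin (n i))} (hU : PT c fun i => encSet (U i))
    (hT : PT c fun i => encSet (T i)) (hR : PT c fun i => encSet (R i)) :
    PT c fun i => encSet (connStep (G i) (U i) (T i) (R i)) := by
  have hn := order hG
  refine set (P := fun i w => w ∈ R i ∨ w ∈ U i ∧ (w ∈ T i ∨ ∃ w', w' ∈ R i ∧ (G i).Adj w w')) hn
    ((mem (hR.weak _ _) (var _ _)).or ((mem (hU.weak _ _) (var _ _)).and
    ((mem (hT.weak _ _) (var _ _)).or (ex hn.weakV ?_)))) (by simp [EternalVC.connStep])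
  exact (mem hR.weakV.weakV (var _ _)).and
    (adj₂ hG)

theorem connSet (hU : PT c fun i => encSet (U i)) (hT : PT c fun i => encSet (T i)) :
    PT c fun i => encSet (connSet (G i) (U i) (T i)) := by
  have hn := order hG
  exact foldSet _ _ hn (empty hn)
    (connStep (hG.weak _ _) (hU.weak _ _) (hT.weak _ _) (var _ _).snd)

theorem nextVertex (hT : PT c fun i => encSet (T i)) (hU : PT c fun i => encSet (U i))
    (ha : PT c fun i => encNat (a i)) :
    PT c fun i => encNat (nextVertex (G i) (T i) (U i) (a i)) := by
  have hn := order hG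
  exact pick hn ((adj (hG.weak _ _) (ha.weak _ _) (var _ _)).and
    (mem ((connSet hG (erase hn hU ha) hT).weak _ _) (var _ _))) ha

/-- The encoding of the state of a path. -/
noncomputable def _root_.EternalVC.encPath {n : ℕ} (s : PathState n) : Data :=
  .cons (encSet s.1) (.cons (encMap s.2.1) (encNat s.2.2))

theorem pathStep {s : ∀ i, PathState (n i)} (hT : PT c fun i => encSet (T i))
    (hs : PT c fun i => encPath (s i)) :
    PT c fun i => encPath (pathStep (G i) (T i) (s i)) := by
  have hn := order hG
  have h1 : PT c fun i => encSet (s i).1 := hs.fst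
  have h2 : PT c fun i => encMap (s i).2.1 := hs.snd.fst
  have h3 : PT c fun i => encNat (s i).2.2 := hs.snd.snd
  have h4 := nextVertex hG hT h1 h3
  refine ((mem hT h3).ite hs ((erase hn h1 h3).pair
    ((update hn h2 h4 h3).pair h4))).congr fun i => ?_
  unfold EternalVC.pathStep
  split <;> rfl

theorem path (hS : PT c fun i => encSet (S i)) (hT : PT c fun i => encSet (T i))
    (ha : PT c fun i => encNat (a i)) (hb : PT c fun i => encNat (b i)) :
    PT c fun i => encPath (path (G i) (S i) (T i) (a i) (b i)) := by
  have hn := order hG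
  refine foldV (fun i (s : PathState (n i)) => encPath s)
    (fun i => (S i, Function.update id (a i) (b i), a i))
    (fun i s _ => EternalVC.pathStep (G i) (T i) s) hn
    (hS.pair ((update hn (mapId hn) ha hb).pair ha))
    (pathStep (hG.weak _ _) (hT.weak _ _) (var _ _).snd) ?_
  have h := hn.polyBdd.reindex (fun j : Σ i, PathState (n i) => j.1)
  have k (m : ℕ) := PolyBdd.const (fun j : Σ i, PathState (n i) => (c j.1).size) m
  refine (((((h.mul (k 4)).add (k 1)).add (((h.mul (((k 2).mul h).add (k 2))).add (k 1)))).add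
    h).add (k 2)).mono fun j => ?_
  obtain ⟨i, s⟩ := j
  have h1 := size_encSet_le s.1
  have h2 := size_encMap_le s.2.1
  have h3 := size_encNat s.2.2
  have h4 := size_encNat (n i)
  have h5 := le_size_encNat (n i)
  have h6 : n i * (2 * n i + 1 + 1) ≤ (encNat (n i)).size * (2 * (encNat (n i)).size + 2) := by
    gcongr <;> omega
  have := s.2.2.isLt
  simp only [encPath, Data.size]
  omega

section Hereditary

variable {H : FinGraph → Prop} (hH : IsHereditary H)
  (hmvc : PolyTimeComputableOn H fun G => mvc G.2) (hHG : ∀ i, H ⟨n i, G i⟩)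
include hH hmvc hHG

/-- Heredity keeps the induced subgraph in `H`, so the given program for mvc may be run on it. -/
theorem mu (hS : PT c fun i => encSet (S i)) : PT c fun i => encNat (mu (G i) (S i)) := by
  have hn := order hG
  have key : PT c fun i => encGraph (sub (G i) (S i)) := by
    refine (filterMap (β := fun i => Fin (n i)) (e := fun i j => encNat j)
      (L := fun i => List.finRange (n i)) (fun i j => j ∈ S i)
      (fun i j => encList (((List.finRange (n i)).filter (· ∈ S i)).map fun k =>
        encBool ((G i).Adj j k))) (range hn) (mem (hS.weak _ _) (var _ _)) ?_).congr fun i => ?_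
    · exact filterMap (β := fun p : Σ i, Fin (n i) => Fin (n p.1)) (e := fun i j => encNat j)
        (L := fun p => List.finRange (n p.1)) (fun p j => j ∈ S p.1)
        (fun p k => encBool ((G p.1).Adj p.2 k)) (range hn.weakV)
        (mem hS.weakV.weakV (var _ _))
        (adj₂ hG)
    · exact (encGraph_comap_get (G i) ((List.finRange (n i)).filter (· ∈ S i))).symm
  have hm : PT (fun G : {G // H G} => encGraph G.1) fun G => encNat (mvc G.1.2) := by
    obtain ⟨p, q, h⟩ := hmvc
    exact ⟨p, q, fun G => h G.1 G.2⟩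
  refine key.trans (hm.reindex fun i => ⟨sub (G i) (S i), hH _ _ (hHG i) ⟨?_⟩⟩)
  refine ⟨⟨_, List.nodup_iff_injective_get.1 ?_⟩, Iff.rfl⟩
  exact (List.nodup_finRange _).filter _

theorem pass (hS : PT c fun i => encSet (S i)) (hT : PT c fun i => encSet (T i)) :
    PT c fun i => encSet (pass (G i) (S i) (T i)) := by
  have hn := order hG
  refine foldSet _ _ hn hT ?_
  have hn' := hn.weak (fun j : Σ i, Finset (Fin (n i)) × Fin (n i) => j.1)
    (fun j => .cons (encNat j.2.2) (encSet j.2.1))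
  have hG' := hG.weak (fun j : Σ i, Finset (Fin (n i)) × Fin (n i) => j.1)
    (fun j => .cons (encNat j.2.2) (encSet j.2.1))
  have hY := (var (fun j : Σ i, Finset (Fin (n i)) × Fin (n i) => c j.1)
    (fun j => .cons (encNat j.2.2) (encSet j.2.1))).snd
  have hw := (var (fun j : Σ i, Finset (Fin (n i)) × Fin (n i) => c j.1)
    (fun j => .cons (encNat j.2.2) (encSet j.2.1))).fst
  simp only [Data.fst, Data.snd] at hY hw
  have hI := insert hn' hY hw
  refine iteSet ((mem (hS.weak _ _) hw).and (natEq
    (mu hG' hH hmvc (fun j => hHG j.1) (compl hn' hI))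
    (mu hG' hH hmvc (fun j => hHG j.1) (compl hn' hY))).not) hI hY

theorem greedyCover (hS : PT c fun i => encSet (S i)) (hT : PT c fun i => encSet (T i)) :
    PT c fun i => encSet (greedyCover (G i) (S i) (T i)) := by
  have hn := order hG
  exact pass hG hH hmvc hHG (univ hn) (pass hG hH hmvc hHG hT (pass hG hH hmvc hHG hS (empty hn)))

theorem partner (hS : PT c fun i => encSet (S i)) (ha : PT c fun i => encNat (a i)) :
    PT c fun i => encNat (partner (G i) (S i) (a i)) := by
  have hn := order hG
  have hE := erase hn hS ha
  refine pick hn ((mem (hS.weak _ _) (var _ _)).and ((adj (hG.weak _ _) (ha.weak _ _)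
    (var _ _)).and (natEq ?_ ?_))) ha
  · exact mu (hG.weak Sigma.fst _) hH hmvc (fun j => hHG j.1)
      (erase (hn.weak _ _) (hE.weak _ _) (var _ _))
  · exact (mu hG hH hmvc hHG hE).weak _ _

/-- The encoding of a set and a map. -/
noncomputable def _root_.EternalVC.encMatch {n : ℕ} (s : Finset (Fin n) × (Fin n → Fin n)) :
    Data :=
  .cons (encSet s.1) (encMap s.2)

theorem matchStep {s : ∀ i, Finset (Fin (n i)) × (Fin (n i) → Fin (n i))}
    (hS : PT c fun i => encSet (S i)) (hs : PT c fun i => encMatch (s i))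
    (ha : PT c fun i => encNat (a i)) :
    PT c fun i => encMatch (matchStep (G i) (S i) (s i) (a i)) := by
  have hn := order hG
  have h1 : PT c fun i => encSet (s i).1 := hs.fst
  have h2 : PT c fun i => encMap (s i).2 := hs.snd
  have hp := partner hG hH hmvc hHG h1 ha
  refine (((mem hS ha).and (mem h1 ha)).ite ((erase hn (erase hn h1 ha) hp).pair
    (update hn h2 ha hp)) hs).congr fun i => ?_
  unfold EternalVC.matchStep
  split <;> rfl

theorem shift (hS : PT c fun i => encSet (S i)) (hT : PT c fun i => encSet (T i))
    (ha : PT c fun i => encNat (a i)) (hb : PT c fun i => encNat (b i)) :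
    PT c fun i => encMap (shift (G i) (S i) (T i) (a i) (b i)) := by
  have hn := order hG
  have hp := path hG hS (sdiff hn hS hT) ha hb
  have h : PT c fun i => encMatch _ :=
    foldV (fun i (s : Finset (Fin (n i)) × (Fin (n i) → Fin (n i))) => encMatch s)
      (fun i => (EternalVC.rest (S i) (T i)
        (EternalVC.path (G i) (S i) (S i \ T i) (a i) (b i)).2.2 (b i),
        (EternalVC.path (G i) (S i) (S i \ T i) (a i) (b i)).2.1))
      (fun i => EternalVC.matchStep (G i) (S i)) hn
      ((rest hn hS hT hp.snd.snd hb).pair hp.snd.fst)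
      (matchStep (hG.weak _ _) hH hmvc (fun j => hHG j.1) (hS.weak _ _) (var _ _).snd
        (var _ _).fst) ?_
  · exact h.snd
  have h := hn.polyBdd.reindex
    (fun j : Σ i, Finset (Fin (n i)) × (Fin (n i) → Fin (n i)) => j.1)
  have k (m : ℕ) := PolyBdd.const
    (fun j : Σ i, Finset (Fin (n i)) × (Fin (n i) → Fin (n i)) => (c j.1).size) m
  refine ((((h.mul (k 4)).add (k 1)).add (((h.mul (((k 2).mul h).add (k 2))).add (k 1)))).add
    (k 1)).mono fun j => ?_
  obtain ⟨i, s⟩ := j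
  have h1 := size_encSet_le s.1
  have h2 := size_encMap_le s.2
  have h4 := size_encNat (n i)
  have h5 := le_size_encNat (n i)
  have h6 : n i * (2 * n i + 1 + 1) ≤ (encNat (n i)).size * (2 * (encNat (n i)).size + 2) := by
    gcongr <;> omega
  simp only [encMatch, Data.size]
  omega

end Hereditary

end Graphs

end PT

/-! ### Connection inside a set of vertices -/

section Conn

variable {n : ℕ} {G : SimpleGraph (Fin n)}

/-- There is a walk inside `U` from a vertex to `T`. -/
inductive Conn (G : SimpleGraph (Fin n)) (U T : Finset (Fin n)) : Fin n → Prop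
  | base {w : Fin n} : w ∈ U → w ∈ T → Conn G U T w
  | step {w w' : Fin n} : w ∈ U → G.Adj w w' → Conn G U T w' → Conn G U T w

theorem Conn.mem {U T : Finset (Fin n)} {w : Fin n} (h : Conn G U T w) : w ∈ U := by
  cases h <;> assumption

theorem Conn.mono {U U' T T' : Finset (Fin n)} (hU : U ⊆ U') (hT : T ⊆ T') {w : Fin n}
    (h : Conn G U T w) : Conn G U' T' w := by
  induction h with
  | base hw ht => exact .base (hU hw) (hT ht)
  | step hw ha _ ih => exact .step (hU hw) ha ih

/-- The next vertex of a path to `T`. -/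
theorem Conn.exists_next {U T : Finset (Fin n)} {w : Fin n} (h : Conn G U T w) (hw : w ∉ T) :
    ∃ w', G.Adj w w' ∧ Conn G (U.erase w) T w' := by
  by_contra! hcon
  -- If no neighbour of `w` reaches `T` while avoiding `w`, then no walk to `T` ever needs `w`, and
  -- even `w` would reach `T` inside `U.erase w`.
  have key : ∀ z, Conn G U T z → Conn G (U.erase w) T z := by
    intro z hz
    induction hz with
    | base hz ht => exact .base (Finset.mem_erase.2 ⟨by rintro rfl; exact hw ht, hz⟩) ht
    | step hz ha _ ih =>
      exact .step (Finset.mem_erase.2 ⟨by rintro rfl; exact hcon _ ha ih, hz⟩) ha ih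
  simpa using (key w h).mem

/-- Until a fixed point is reached, each application adds a vertex; after `n` applications the set
is fixed or already contains all vertices. -/
theorem iterate_fixed {f : Finset (Fin n) → Finset (Fin n)} (hf : ∀ R, R ⊆ f R) :
    f (f^[n] ∅) = f^[n] ∅ := by
  have key : ∀ k, f (f^[k] ∅) = f^[k] ∅ ∨ k ≤ (f^[k] ∅).card := by
    intro k
    induction k with
    | zero => simp
    | succ k ih =>
      rw [Function.iterate_succ_apply']
      by_cases h : f (f^[k] ∅) = f^[k] ∅
      · left
        rw [h, h]
      · right
        have h1 := Finset.card_lt_card ((hf (f^[k] ∅)).ssubset_of_ne (Ne.symm h))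
        have h2 := ih.resolve_left h
        omega
  rcases key n with h | h
  · exact h
  · have h1 : f^[n] ∅ = Finset.univ :=
      Finset.card_eq_iff_eq_univ _ |>.1 (le_antisymm (Finset.card_le_univ _) (by simpa using h))
    have h2 := hf (f^[n] ∅)
    rw [h1] at h2 ⊢
    exact Finset.univ_subset_iff.1 h2

theorem mem_connSet {U T : Finset (Fin n)} {w : Fin n} :
    w ∈ connSet G U T ↔ Conn G U T w := by
  unfold connSet
  rw [List.foldl_const, List.length_finRange]
  constructor
  · have key : ∀ k w, w ∈ (connStep G U T)^[k] ∅ → Conn G U T w := by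
      intro k
      induction k with
      | zero => simp
      | succ k ih =>
        intro w hw
        rw [Function.iterate_succ_apply'] at hw
        simp only [connStep, Finset.mem_filter, Finset.mem_univ, true_and] at hw
        rcases hw with hw | ⟨hw, hT | ⟨w', hw', ha⟩⟩
        · exact ih w hw
        · exact .base hw hT
        · exact .step hw ha (ih w' hw')
    exact key n w
  · have hfix := iterate_fixed (f := connStep G U T) fun R w hw => by simp [connStep, hw]
    intro h
    induction h with
    | base hw ht =>
      rw [← hfix]
      simp [connStep, hw, ht]
    | step hw ha _ ih =>
      rw [← hfix]
      simp only [connStep, Finset.mem_filter, Finset.mem_univ, true_and]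
      exact .inr ⟨hw, .inr ⟨_, ih, ha⟩⟩

/-- This links the relation computed by the search with reachability in induced subgraphs, the
language of cut vertices and of the class F. -/
theorem conn_singleton_iff {U : Finset (Fin n)} {W : Set (Fin n)} (hUW : ∀ x, x ∈ U ↔ x ∈ W)
    {u v : Fin n} : Conn G U {v} u ↔
      ∃ (hu : u ∈ W) (hv : v ∈ W), (G.induce W).Reachable ⟨u, hu⟩ ⟨v, hv⟩ := by
  constructor
  · intro h
    induction h with
    | base hu hT =>
      rw [Finset.mem_singleton] at hT
      subst hT
      exact ⟨(hUW _).1 hu, (hUW _).1 hu, .rfl⟩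
    | step hu ha _ ih =>
      obtain ⟨hu', hv, h⟩ := ih
      refine ⟨(hUW _).1 hu, hv, SimpleGraph.Reachable.trans (SimpleGraph.Adj.reachable ?_) h⟩
      exact ha
  · rintro ⟨hu, hv, ⟨p⟩⟩
    have key : ∀ (a b : W), (G.induce W).Walk a b → Conn G U {b.1} a.1 := by
      intro a b p
      induction p with
      | nil => exact .base ((hUW _).2 (Subtype.property _)) (by simp)
      | @cons a _ _ ha _ ih => exact .step ((hUW _).2 a.2) ha ih
    exact key _ _ p

theorem conn_univ_iff {u v : Fin n} : Conn G Finset.univ {v} u ↔ G.Reachable u v := by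
  rw [conn_singleton_iff (W := Set.univ) (by simp)]
  constructor
  · rintro ⟨_, _, h⟩
    exact h.map (SimpleGraph.Embedding.induce _).toHom
  · intro h
    exact ⟨trivial, trivial, h.map (SimpleGraph.induceUnivIso G).symm.toHom⟩

theorem isCutVertex_iff {x : Fin n} : IsCutVertex G x ↔
    ∃ u v, (u ≠ x ∧ v ≠ x) ∧ Conn G Finset.univ {v} u ∧ ¬ Conn G {x}ᶜ {v} u := by
  have h := fun u v => conn_singleton_iff (G := G) (U := ({x}ᶜ : Finset (Fin n)))
    (W := ({x}ᶜ : Set (Fin n))) (by simp) (u := u) (v := v)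
  simp only [h, conn_univ_iff, IsCutVertex]
  constructor
  · rintro ⟨u, v, hu, hv, h1, h2⟩
    exact ⟨u, v, ⟨hu, hv⟩, h1, by rintro ⟨_, _, h3⟩; exact h2 h3⟩
  · rintro ⟨u, v, ⟨hu, hv⟩, h1, h2⟩
    exact ⟨u, v, hu, hv, h1, fun h3 => h2 ⟨hu, hv, h3⟩⟩

theorem mem_cutSet {x : Fin n} : x ∈ cutSet G ↔ IsCutVertex G x := by
  simp [cutSet]

end Conn

/-! ### Minimum vertex covers -/

section Covers

variable {n : ℕ} {G : SimpleGraph (Fin n)}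

theorem mvc_le {S : Finset (Fin n)} (h : G.IsVertexCover S) : mvc G ≤ S.card := by
  have h1 := h.vertexCoverNum_le
  rw [Set.encard_coe_eq_coe_finsetCard] at h1
  exact ENat.toNat_le_of_le_natCast h1

theorem exists_mvc (G : SimpleGraph (Fin n)) :
    ∃ S : Finset (Fin n), G.IsVertexCover S ∧ S.card = mvc G := by
  obtain ⟨s, hs, hc⟩ := G.vertexCoverNum_exists
  refine ⟨s.toFinset, by simpa using hc, ?_⟩
  rw [mvc, ← hs, ← Set.coe_toFinset s, Set.encard_coe_eq_coe_finsetCard]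
  simp

/-- The embedding of the renumbered induced subgraph. -/
noncomputable def subEmb (G : SimpleGraph (Fin n)) (S : Finset (Fin n)) : (sub G S).2 ↪g G :=
  ⟨⟨_, List.nodup_iff_injective_get.1 ((List.nodup_finRange n).filter (· ∈ S))⟩, Iff.rfl⟩

theorem exists_subEmb_iff {S : Finset (Fin n)} {x : Fin n} :
    (∃ i, subEmb G S i = x) ↔ x ∈ S := by
  have h : (∃ i, subEmb G S i = x) ↔ x ∈ (List.finRange n).filter (· ∈ S) :=
    List.mem_iff_get.symm
  simp [h]

theorem subEmb_mem {S : Finset (Fin n)} (i : Fin (sub G S).1) : subEmb G S i ∈ S :=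
  exists_subEmb_iff.1 ⟨i, rfl⟩

/-- `T` meets all edges inside `S`. -/
def CoversOn (G : SimpleGraph (Fin n)) (S T : Finset (Fin n)) : Prop :=
  ∀ a ∈ S, ∀ b ∈ S, G.Adj a b → a ∈ T ∨ b ∈ T

/-- `T` may leave `S`: only its trace on `S` is needed to cover the induced subgraph. -/
theorem mu_le {S T : Finset (Fin n)} (h : CoversOn G S T) : mu G S ≤ T.card := by
  have hc : (sub G S).2.IsVertexCover ((Finset.univ.filter fun i => subEmb G S i ∈ T :
      Finset (Fin (sub G S).1)) : Set (Fin (sub G S).1)) := by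
    intro i j hij
    simpa using h _ (subEmb_mem i) _ (subEmb_mem j) ((subEmb G S).map_adj_iff.2 hij)
  refine (mvc_le hc).trans (Finset.card_le_card_of_injOn (subEmb G S)
    (fun i hi => by simpa using hi) ?_)
  exact (subEmb G S).injective.injOn

theorem exists_mu (G : SimpleGraph (Fin n)) (S : Finset (Fin n)) :
    ∃ T ⊆ S, CoversOn G S T ∧ T.card = mu G S := by
  obtain ⟨R, hR, hcard⟩ := exists_mvc (sub G S).2
  refine ⟨R.map (subEmb G S).toEmbedding, ?_, ?_, by rw [Finset.card_map]; exact hcard⟩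
  · intro x hx
    obtain ⟨i, _, rfl⟩ := Finset.mem_map.1 hx
    exact subEmb_mem i
  · intro a ha b hb hab
    obtain ⟨i, rfl⟩ := exists_subEmb_iff (G := G).2 ha
    obtain ⟨j, rfl⟩ := exists_subEmb_iff (G := G).2 hb
    rcases hR ((subEmb G S).map_adj_iff.1 hab) with h | h
    · exact .inl (Finset.mem_map.2 ⟨i, h, rfl⟩)
    · exact .inr (Finset.mem_map.2 ⟨j, h, rfl⟩)

theorem mu_mono {S S' : Finset (Fin n)} (h : S ⊆ S') : mu G S ≤ mu G S' := by
  obtain ⟨T, _, hT, hc⟩ := exists_mu G S'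
  exact hc ▸ mu_le fun a ha b hb => hT a (h ha) b (h hb)

/-- `Y` is contained in a minimum vertex cover. -/
def Ext (G : SimpleGraph (Fin n)) (Y : Finset (Fin n)) : Prop :=
  ∃ T : Finset (Fin n), (G.IsVertexCover T ∧ T.card = mvc G) ∧ Y ⊆ T

theorem Ext.mono {Y Y' : Finset (Fin n)} (h : Y ⊆ Y') (hY : Ext G Y') : Ext G Y :=
  let ⟨T, hT, hY⟩ := hY; ⟨T, hT, h.trans hY⟩

theorem ext_empty (G : SimpleGraph (Fin n)) : Ext G ∅ :=
  let ⟨T, hT⟩ := exists_mvc G; ⟨T, hT, by simp⟩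

theorem mvc_le_mu_add (Y : Finset (Fin n)) : mvc G ≤ mu G Yᶜ + Y.card := by
  obtain ⟨T, _, hT, hc⟩ := exists_mu G Yᶜ
  rw [← hc]
  refine (mvc_le (S := T ∪ Y) ?_).trans (Finset.card_union_le _ _)
  intro a b hab
  simp only [Finset.coe_union, Set.mem_union, Finset.mem_coe]
  by_cases ha : a ∈ Y
  · tauto
  by_cases hb : b ∈ Y
  · tauto
  have := hT a (by simpa) b (by simpa) hab
  tauto

/-- A minimum cover containing `Y` leaves, outside `Y`, a cover of the remaining graph; conversely
an optimal cover of the remaining graph is completed by `Y`. The question whether `Y` extends thus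
becomes a comparison of mvc values. -/
theorem ext_iff {Y : Finset (Fin n)} : Ext G Y ↔ mu G Yᶜ + Y.card = mvc G := by
  constructor
  · rintro ⟨T, ⟨hT, hc⟩, hY⟩
    refine le_antisymm ?_ (mvc_le_mu_add Y)
    have h1 : mu G Yᶜ ≤ (T \ Y).card := by
      refine mu_le fun a ha b hb hab => ?_
      have := hT hab
      simp_all
    have h2 := Finset.card_sdiff_add_card_eq_card hY
    omega
  · intro h
    obtain ⟨T, hTY, hT, hc⟩ := exists_mu G Yᶜ
    refine ⟨T ∪ Y, ⟨?_, ?_⟩, Finset.subset_union_right⟩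
    · intro a b hab
      simp only [Finset.coe_union, Set.mem_union, Finset.mem_coe]
      by_cases ha : a ∈ Y
      · tauto
      by_cases hb : b ∈ Y
      · tauto
      have := hT a (by simpa) b (by simpa) hab
      tauto
    · rw [Finset.card_union_of_disjoint, hc, h]
      exact Finset.disjoint_left.2 fun x hx => by simpa using hTY hx

/-- Deleting one more vertex lowers the cover number by at most one, and by `ext_iff` it is lowered
exactly when the larger set still extends. -/
theorem mu_insert_ne_iff {Y : Finset (Fin n)} (hY : Ext G Y) (w : Fin n) :
    mu G (insert w Y)ᶜ ≠ mu G Yᶜ ↔ w ∉ Y ∧ Ext G (insert w Y) := by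
  by_cases hw : w ∈ Y
  · simp [hw]
  have h1 := mvc_le_mu_add (G := G) (insert w Y)
  have h2 := mu_mono (G := G) (Finset.compl_subset_compl.2 (Finset.subset_insert w Y))
  rw [ext_iff] at hY ⊢
  rw [Finset.card_insert_of_notMem hw] at *
  simp only [hw, not_false_eq_true, true_and]
  omega

/-- A single pass suffices: a vertex that is rejected once cannot be added later, because `Ext`
passes to subsets. -/
theorem pass_spec {P Y : Finset (Fin n)} (hY : Ext G Y) :
    Y ⊆ pass G P Y ∧ Ext G (pass G P Y) ∧ pass G P Y ⊆ Y ∪ P ∧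
      ∀ w ∈ P, w ∉ pass G P Y → ¬ Ext G (insert w (pass G P Y)) := by
  have key : ∀ (l : List (Fin n)) (Y : Finset (Fin n)), Ext G Y →
      let Z := l.foldl
        (fun Y w => if w ∈ P ∧ mu G (insert w Y)ᶜ ≠ mu G Yᶜ then insert w Y else Y) Y
      Y ⊆ Z ∧ Ext G Z ∧ Z ⊆ Y ∪ P ∧ ∀ w ∈ l, w ∈ P → w ∉ Z → ¬ Ext G (insert w Z) := by
    intro l
    induction l with
    | nil => simp
    | cons a l ih =>
      intro Y hY
      simp only [List.foldl_cons]
      have hiff := mu_insert_ne_iff hY a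
      by_cases ha : a ∈ P ∧ mu G (insert a Y)ᶜ ≠ mu G Yᶜ
      · rw [if_pos ha]
        obtain ⟨h1, h2, h3, h4⟩ := ih _ (hiff.1 ha.2).2
        refine ⟨(Finset.subset_insert _ _).trans h1, h2, h3.trans ?_, ?_⟩
        · intro x hx
          have := ha.1
          simp only [Finset.mem_union, Finset.mem_insert] at hx ⊢
          rcases hx with (rfl | hx) | hx <;> tauto
        · intro w hw hwP hwZ
          rcases List.mem_cons.1 hw with rfl | hw
          · exact absurd (h1 (Finset.mem_insert_self _ _)) hwZ
          · exact h4 w hw hwP hwZ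
      · rw [if_neg ha]
        obtain ⟨h1, h2, h3, h4⟩ := ih _ hY
        refine ⟨h1, h2, h3, ?_⟩
        intro w hw hwP hwZ
        rcases List.mem_cons.1 hw with rfl | hw
        · intro hext
          exact ha ⟨hwP, hiff.2 ⟨fun h => hwZ (h1 h), hext.mono (Finset.insert_subset_insert _ h1)⟩⟩
        · exact h4 w hw hwP hwZ
  obtain ⟨h1, h2, h3, h4⟩ := key (List.finRange n) Y hY
  exact ⟨h1, h2, h3, fun w => h4 w (List.mem_finRange w)⟩

/-- After the last pass the set lies in some minimum cover `T`. A missing vertex of `T` could still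
have been added, so the set equals `T`. This needs no assumption on `X`. -/
theorem greedyCover_cover (G : SimpleGraph (Fin n)) (X S : Finset (Fin n)) :
    G.IsVertexCover (greedyCover G X S) ∧ (greedyCover G X S).card = mvc G := by
  have h1 := pass_spec (P := X) (ext_empty G)
  have h2 := pass_spec (P := S) h1.2.1
  obtain ⟨-, ⟨T, hT, hs⟩, -, h⟩ := pass_spec (P := Finset.univ) h2.2.1
  have : greedyCover G X S = T := by
    refine hs.antisymm fun w hw => ?_
    by_contra hcon
    exact h w (Finset.mem_univ _) hcon ⟨T, hT, Finset.insert_subset hw hs⟩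
  rwa [this]

/-- The first pass stays inside `X`, and all subsets of `X` extend, so it rejects no vertex of `X`.
-/
theorem subset_greedyCover {X S : Finset (Fin n)} (hX : Ext G X) : X ⊆ greedyCover G X S := by
  obtain ⟨-, h1, h1', h1''⟩ := pass_spec (P := X) (ext_empty G)
  have h2 := pass_spec (P := S) h1
  have h3 := pass_spec (P := Finset.univ) h2.2.1
  refine fun w hw => h3.1 (h2.1 ?_)
  by_contra hcon
  refine h1'' w hw hcon (hX.mono (Finset.insert_subset hw ?_))
  simpa using h1'

/-- The set `S ∩ greedyCover G X S` is maximal. -/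
theorem greedyCover_maximal {X S T : Finset (Fin n)} (hT : G.IsVertexCover T)
    (hTc : T.card = mvc G) (hX : X ⊆ T) (hS : ∀ w ∈ S, w ∈ greedyCover G X S → w ∈ T) {w : Fin n}
    (hwS : w ∈ S) (hwT : w ∈ T) : w ∈ greedyCover G X S := by
  obtain ⟨-, h1, h1', -⟩ := pass_spec (P := X) (ext_empty G)
  have h2 := pass_spec (P := S) h1
  have h3 := pass_spec (P := Finset.univ) h2.2.1
  refine h3.1 ?_
  by_contra hcon
  refine h2.2.2.2 w hwS hcon ⟨T, ⟨hT, hTc⟩, Finset.insert_subset hwT fun x hx => ?_⟩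
  -- All vertices chosen in the first two passes come from `X` or `S` and hence lie in `T`. So `T`
  -- witnesses that `w` should have been accepted.
  rcases Finset.mem_union.1 (h2.2.2.1 hx) with hx' | hx'
  · exact hX (by simpa using h1' hx')
  · exact hS x hx' (h3.1 hx)

theorem extendable_iff : Extendable G ↔
    ∀ v, (∃ w, G.Adj v w) → Ext G (insert v (cutSet G)) := by
  refine forall₂_congr fun v _ => ?_
  constructor
  · intro h
    refine ⟨_, greedyCover_cover G (insert v (cutSet G)) ∅, fun x hx => h x ?_⟩
    simpa using hx
  · intro h x hx
    exact subset_greedyCover h (by simpa using hx)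

end Covers

/-! ### Polynomial time for cut vertices, extendability and the strategy -/

namespace PT

variable {ι : Type} {c : ι → Data} {n : ι → ℕ} {G : ∀ i, SimpleGraph (Fin (n i))}
  {S T : ∀ i, Finset (Fin (n i))} {a b x : ∀ i, Fin (n i)}

theorem imp {P Q : ι → Prop} (hP : PT c fun i => encBool (P i))
    (hQ : PT c fun i => encBool (Q i)) : PT c fun i => encBool (P i → Q i) :=
  (hP.not.or hQ).congr fun i => by congr 1; exact propext imp_iff_not_or.symm

theorem singleton (hn : PT c fun i => encNat (n i)) (ha : PT c fun i => encNat (a i)) :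
    PT c fun i => encSet ({a i} : Finset (Fin (n i))) :=
  (insert hn (empty hn) ha).congr fun i => by simp

theorem varV : PT (fun k : Σ i, Fin (n i) => .cons (c k.1) (encNat k.2)) fun k => encNat k.2 :=
  var _ _

section

variable (hG : PT c fun i => encGraph ⟨n i, G i⟩)
include hG

theorem separated (ha : PT c fun i => encNat (a i)) (hb : PT c fun i => encNat (b i))
    (hx : PT c fun i => encNat (x i)) :
    PT c fun i => encBool ((a i ≠ x i ∧ b i ≠ x i) ∧ Conn (G i) Finset.univ {b i} (a i) ∧
      ¬ Conn (G i) {x i}ᶜ {b i} (a i)) := by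
  have hn := order hG
  have hs := singleton hn hb
  refine (((finEq ha hx).not.and (finEq hb hx).not).and
    ((mem (connSet hG (univ hn) hs) ha).and
      (mem (connSet hG (compl hn (singleton hn hx)) hs) ha).not)).congr fun i => ?_
  simp only [mem_connSet]

theorem isCutVertex (hx : PT c fun i => encNat (x i)) :
    PT c fun i => encBool (IsCutVertex (G i) (x i)) := by
  have hn := order hG
  simp only [isCutVertex_iff]
  refine ex hn (ex hn.weakV ?_)
  exact separated (n := fun k : Σ p : Σ i, Fin (n i), Fin (n p.1) => n k.1.1)
    (G := fun k => G k.1.1) (a := fun k => k.1.2) (b := fun k => k.2) (x := fun k => x k.1.1)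
    hG.weakV.weakV (varV (c := c) (n := n)).weakV (var _ _) hx.weakV.weakV

theorem cutSet : PT c fun i => encSet (cutSet (G i)) := by
  have hn := order hG
  exact set hn (isCutVertex hG.weakV varV) fun i j => mem_cutSet

theorem notIsolated (ha : PT c fun i => encNat (a i)) :
    PT c fun i => encBool (∃ w, (G i).Adj (a i) w) :=
  ex (order hG) (adj hG.weakV ha.weakV varV)

variable {H : FinGraph → Prop} (hH : IsHereditary H)
  (hmvc : PolyTimeComputableOn H fun G => mvc G.2) (hHG : ∀ i, H ⟨n i, G i⟩)
include hH hmvc hHG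

theorem covered (ha : PT c fun i => encNat (a i)) :
    PT c fun i => encBool (∀ x, x = a i ∨ x ∈ EternalVC.cutSet (G i) →
      x ∈ EternalVC.greedyCover (G i) (Insert.insert (a i) (EternalVC.cutSet (G i))) ∅) := by
  have hn := order hG
  have hX := cutSet hG
  exact all hn (((finEq varV ha.weakV).or (mem hX.weakV varV)).imp
    (mem (greedyCover hG hH hmvc hHG (insert hn hX ha) (empty hn)).weakV varV))

theorem extendable : PT c fun i => encBool (Extendable (G i)) := by
  have hn := order hG
  exact all hn ((notIsolated hG.weakV varV).imp
    (covered hG.weakV hH hmvc (fun k => hHG k.1) varV))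

theorem startConf : PT c fun i => encSet (startConf (G i)) := by
  have hn := order hG
  have h := greedyCover hG hH hmvc hHG (cutSet hG) (empty hn)
  exact iteSet (extendable hG hH hmvc hHG) h (addOne hn h)

theorem target (hS : PT c fun i => encSet (S i)) (hb : PT c fun i => encNat (b i)) :
    PT c fun i => encSet (target (G i) (S i) (b i)) := by
  have hn := order hG
  have hX := cutSet hG
  exact iteSet (extendable hG hH hmvc hHG) (greedyCover hG hH hmvc hHG (insert hn hX hb) hS)
    (insert hn (greedyCover hG hH hmvc hHG hX (empty hn)) hb)

theorem answer (hS : PT c fun i => encSet (S i)) (ha : PT c fun i => encNat (a i))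
    (hb : PT c fun i => encNat (b i)) :
    PT c fun i => encMap (answer (G i) (S i) (a i) (b i)) := by
  have hn := order hG
  refine ((mem hS ha).ite ((mem hS hb).ite (update hn (update hn (mapId hn) ha hb) hb ha)
    (shift hG hH hmvc hHG hS (target hG hH hmvc hHG hS hb) ha hb))
    (shift hG hH hmvc hHG hS (target hG hH hmvc hHG hS ha) hb ha)).congr fun i => ?_
  unfold EternalVC.answer
  split
  · split <;> rfl
  · rfl

end

end PT

/-! ### Correctness of the guard movements -/

section Shift

variable {n : ℕ} {G : SimpleGraph (Fin n)}

/-- The guards on `S` move along `f` to `Q`, each guard by at most one edge. -/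
structure Moves (G : SimpleGraph (Fin n)) (S Q : Finset (Fin n)) (f : Fin n → Fin n) : Prop where
  adj : ∀ w ∈ S, f w = w ∨ G.Adj w (f w)
  inj : Set.InjOn f S
  image : S.image f = Q

/-- The path and the matching are both assembled from this single change: a guard that has not moved
yet is sent to a vertex that is free in the current result. -/
theorem Moves.update {S Q : Finset (Fin n)} {f : Fin n → Fin n} (h : Moves G S Q f) {z y : Fin n}
    (hz : z ∈ S) (hzy : G.Adj z y) (hfz : f z = z) (hy : y ∉ Q) :
    Moves G S (insert y (Q.erase z)) (Function.update f z y) := by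
  obtain ⟨h1, h2, rfl⟩ := h
  have hy' : ∀ w ∈ S, f w ≠ y := by simpa using hy
  refine ⟨fun w hw => ?_, fun w hw w' hw' hww => ?_, ?_⟩
  · by_cases hwz : w = z
    · subst hwz
      simp [hzy]
    · simpa [hwz] using h1 w hw
  · by_cases hwz : w = z <;> by_cases hwz' : w' = z
    · rw [hwz, hwz']
    · subst hwz
      simp only [Function.update_self, Function.update_of_ne hwz'] at hww
      exact absurd hww.symm (hy' w' hw')
    · subst hwz'
      simp only [Function.update_self, Function.update_of_ne hwz] at hww
      exact absurd hww (hy' w hw)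
    · simp only [Function.update_of_ne hwz, Function.update_of_ne hwz'] at hww
      exact h2 hw hw' hww
  · ext x
    simp only [Finset.mem_image, Finset.mem_insert, Finset.mem_erase]
    constructor
    · rintro ⟨w, hw, rfl⟩
      by_cases hwz : w = z
      · subst hwz
        simp
      · refine .inr ⟨?_, w, hw, by simp [hwz]⟩
        simp only [Function.update_of_ne hwz]
        intro h
        exact hwz (h2 hw hz (h.trans hfz.symm))
    · rintro (rfl | ⟨hxz, w, hw, rfl⟩)
      · exact ⟨z, hz, by simp⟩
      · refine ⟨w, hw, ?_⟩
        rw [Function.update_of_ne]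
        rintro rfl
        exact hxz hfz

/-- The invariant of the search for a path from `a` to `T`. -/
structure PathInv (G : SimpleGraph (Fin n)) (S T : Finset (Fin n)) (a b : Fin n)
    (s : PathState n) : Prop where
  conn : Conn G s.1 T s.2.2
  sub : s.1 ⊆ S
  moves : Moves G S (insert b (S.erase s.2.2)) s.2.1
  attacked : s.2.1 a = b
  unvisited : ∀ z ∈ s.1, z ≠ s.2.2 → s.2.1 z = z
  start : a ∈ s.1 → a = s.2.2
  targets : T ⊆ s.1

/-- The current vertex has just been vacated, and the next one still has its own guard because it is
unvisited; that guard steps back onto the current vertex. -/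
theorem PathInv.next {S T : Finset (Fin n)} {a b : Fin n} {s : PathState n}
    (h : PathInv G S T a b s) (hb : b ∉ S) : PathInv G S T a b (pathStep G T s) := by
  unfold pathStep
  split
  · exact h
  rename_i hw
  obtain ⟨hadj, hconn⟩ : G.Adj s.2.2 (nextVertex G T s.1 s.2.2) ∧
      nextVertex G T s.1 s.2.2 ∈ connSet G (s.1.erase s.2.2) T := by
    obtain ⟨w', h1, h2⟩ := h.conn.exists_next hw
    exact pick_spec (P := fun w' => G.Adj s.2.2 w' ∧ w' ∈ connSet G (s.1.erase s.2.2) T) _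
      ⟨w', h1, mem_connSet.2 h2⟩
  rw [mem_connSet] at hconn
  generalize nextVertex G T s.1 s.2.2 = w' at hadj hconn
  obtain ⟨hne, hw'⟩ := Finset.mem_erase.1 hconn.mem
  have hwS : s.2.2 ∈ S := h.sub h.conn.mem
  have hwb : s.2.2 ≠ b := fun h => hb (h ▸ hwS)
  have hwb' : w' ≠ b := fun h' => hb (h' ▸ h.sub hw')
  refine ⟨hconn, (Finset.erase_subset _ _).trans h.sub, ?_, ?_, ?_, ?_, ?_⟩
  · have := h.moves.update (h.sub hw') hadj.symm (h.unvisited _ hw' hne) (y := s.2.2)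
      (by simp [hwb])
    convert this using 1
    ext x
    simp only [Finset.mem_insert, Finset.mem_erase]
    by_cases hx : x = s.2.2
    · subst hx
      simp [hwS, hne.symm]
    · by_cases hxb : x = b
      · subst hxb
        simp [hwb'.symm]
      · simp [hx, hxb]
  · show Function.update s.2.1 w' s.2.2 a = b
    rw [Function.update_of_ne, h.attacked]
    rintro rfl
    -- The guard of `a` is never redirected: `a` is unvisited only while it is the current vertex.
    exact hne (h.start hw')
  · intro z hz hzw
    obtain ⟨hz1, hz2⟩ := Finset.mem_erase.1 hz
    show Function.update s.2.1 w' s.2.2 z = z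
    rw [Function.update_of_ne hzw]
    exact h.unvisited z hz2 hz1
  · intro ha
    obtain ⟨hz1, hz2⟩ := Finset.mem_erase.1 ha
    exact absurd (h.start hz2) hz1
  · intro t ht
    exact Finset.mem_erase.2 ⟨by rintro rfl; exact hw ht, h.targets ht⟩

/-- Each step before `T` is reached deletes a vertex from the unvisited set, which always retains
the current vertex. Hence `n` steps are enough. -/
theorem path_spec {S T : Finset (Fin n)} {a b : Fin n} (hT : T ⊆ S) (hb : b ∉ S)
    (hab : G.Adj a b) (hconn : Conn G S T a) :
    PathInv G S T a b (path G S T a b) ∧ (path G S T a b).2.2 ∈ T := by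
  have haS := hconn.mem
  have h0 : PathInv G S T a b (S, Function.update id a b, a) := by
    refine ⟨hconn, subset_rfl, ?_, by simp, fun z _ hz => Function.update_of_ne hz _ _,
      fun _ => rfl, hT⟩
    have : Moves G S S id := ⟨fun _ _ => .inl rfl, Function.injective_id.injOn, by simp⟩
    exact this.update haS hab rfl hb
  unfold path
  rw [List.foldl_const, List.length_finRange]
  have key : ∀ k, PathInv G S T a b ((pathStep G T)^[k] (S, Function.update id a b, a)) ∧
      (((pathStep G T)^[k] (S, Function.update id a b, a)).2.2 ∈ T ∨
        ((pathStep G T)^[k] (S, Function.update id a b, a)).1.card + k ≤ n) := by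
    intro k
    induction k with
    | zero => exact ⟨h0, .inr (by simpa using Finset.card_le_univ S)⟩
    | succ k ih =>
      rw [Function.iterate_succ_apply']
      generalize (pathStep G T)^[k] (S, Function.update id a b, a) = s at ih
      refine ⟨ih.1.next hb, ?_⟩
      by_cases hs : s.2.2 ∈ T
      · left
        rw [pathStep, if_pos hs]
        exact hs
      · right
        rw [pathStep, if_neg hs]
        have := Finset.card_erase_add_one ih.1.conn.mem
        have := ih.2.resolve_left hs
        dsimp only
        omega
  obtain ⟨h1, h2⟩ := key n
  refine ⟨h1, h2.resolve_right fun h => ?_⟩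
  have := Finset.card_pos.2 ⟨_, h1.conn.mem⟩
  omega

/-- A vertex in one side of a bipartite graph that has a matching covering this side can be matched
such that the remaining graph has such a matching, too. -/
theorem exists_partner {A B : Finset (Fin n)} (hAB : Disjoint A B)
    (hA : ∀ p ∈ A, ∀ q ∈ A, ¬ G.Adj p q) (hB : ∀ p ∈ B, ∀ q ∈ B, ¬ G.Adj p q)
    (hmu : mu G (A ∪ B) = A.card) {z : Fin n} (hz : z ∈ A) :
    mu G ((A ∪ B).erase z) = A.card - 1 ∧
      ∃ y ∈ B, G.Adj z y ∧ mu G (((A ∪ B).erase z).erase y) = A.card - 1 := by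
  have hle : mu G ((A ∪ B).erase z) ≤ A.card - 1 := by
    rw [← Finset.card_erase_of_mem hz]
    refine mu_le fun p hp q hq hpq => ?_
    simp only [Finset.mem_erase, Finset.mem_union] at hp hq ⊢
    by_contra! hcon
    have hp' : p ∈ B := by tauto
    have hq' : q ∈ B := by tauto
    exact hB p hp' q hq' hpq
  -- Hall's condition holds because `A` without a subset `s`, together with the neighbours of `s` in
  -- `B`, covers the graph and so has at least `A.card` elements.
  obtain ⟨g, hg, hgB⟩ := (Finset.all_card_le_biUnion_card_iff_exists_injective
    fun p : A => B.filter (G.Adj p)).1 (by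
      intro s
      let s' : Finset (Fin n) := s.map (Function.Embedding.subtype _)
      have hs' : s' ⊆ A := by
        intro x hx
        obtain ⟨y, _, rfl⟩ := Finset.mem_map.1 hx
        exact y.2
      have hcov : CoversOn G (A ∪ B) ((A \ s') ∪ s.biUnion fun p : A => B.filter (G.Adj p)) := by
        have key : ∀ p ∈ A, ∀ q ∈ B, G.Adj p q →
            p ∈ (A \ s') ∪ (s.biUnion fun p : A => B.filter (G.Adj p)) ∨
            q ∈ (A \ s') ∪ (s.biUnion fun p : A => B.filter (G.Adj p)) := by
          intro p hp q hq hpq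
          by_cases hps : p ∈ s'
          · right
            obtain ⟨y, hy, rfl⟩ := Finset.mem_map.1 hps
            exact Finset.mem_union_right _ (Finset.mem_biUnion.2
              ⟨y, hy, Finset.mem_filter.2 ⟨hq, hpq⟩⟩)
          · left
            exact Finset.mem_union_left _ (Finset.mem_sdiff.2 ⟨hp, hps⟩)
        intro p hp q hq hpq
        rcases Finset.mem_union.1 hp with hp | hp <;> rcases Finset.mem_union.1 hq with hq | hq
        · exact absurd hpq (hA p hp q hq)
        · exact key p hp q hq hpq
        · exact (key q hq p hp hpq.symm).symm
        · exact absurd hpq (hB p hp q hq)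
      have h1 := (mu_le hcov).trans (Finset.card_union_le _ _)
      have h2 := Finset.card_sdiff_add_card_eq_card hs'
      have h3 : s'.card = s.card := Finset.card_map _
      omega)
  have hgB' : ∀ p : A, g p ∈ B ∧ G.Adj p (g p) := fun p => Finset.mem_filter.1 (hgB p)
  -- The matching edges at the vertices of `A` other than `z` survive the deletion and are disjoint.
  -- A cover needs an endpoint of each, chosen by the injection below.
  have hge : A.card - 1 ≤ mu G (((A ∪ B).erase z).erase (g ⟨z, hz⟩)) := by
    obtain ⟨T, _, hT, hc⟩ := exists_mu G (((A ∪ B).erase z).erase (g ⟨z, hz⟩))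
    rw [← hc, ← Finset.card_erase_of_mem hz, ← Finset.card_attach]
    have hmem : ∀ p : {x // x ∈ A.erase z}, p.1 ∈ A := fun p => Finset.mem_of_mem_erase p.2
    have hdis : ∀ p ∈ A, p ∉ B := fun p hp => Finset.disjoint_left.1 hAB hp
    refine Finset.card_le_card_of_injOn
      (fun p => if p.1 ∈ T then p.1 else g ⟨p.1, hmem p⟩) ?_ ?_
    · intro p _
      have hpz : p.1 ≠ z := Finset.ne_of_mem_erase p.2
      have h1 := hgB' ⟨p.1, hmem p⟩
      have h2 := hT p.1 (by
        refine Finset.mem_erase.2 ⟨?_, Finset.mem_erase.2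
          ⟨hpz, Finset.mem_union_left _ (hmem p)⟩⟩
        intro h
        exact hdis _ (hmem p) (h ▸ (hgB' _).1)) (g ⟨p.1, hmem p⟩) (by
        refine Finset.mem_erase.2 ⟨?_, Finset.mem_erase.2 ⟨?_, Finset.mem_union_right _ h1.1⟩⟩
        · intro h
          exact hpz (congrArg Subtype.val (hg h))
        · intro h
          exact hdis z hz (h ▸ h1.1)) h1.2
      dsimp only
      split
      · assumption
      · exact h2.resolve_left ‹_›
    · intro p _ q _ hpq
      dsimp only at hpq
      split at hpq <;> split at hpq
      · exact Subtype.ext hpq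
      · exact absurd (hpq ▸ (hgB' _).1) (hdis _ (hmem p))
      · exact absurd (hpq ▸ (hgB' _).1) (hdis _ (hmem q))
      · exact Subtype.ext (Subtype.mk.inj (hg hpq))
  have hmono := mu_mono (G := G) (Finset.erase_subset (g ⟨z, hz⟩) ((A ∪ B).erase z))
  exact ⟨by omega, g ⟨z, hz⟩, (hgB' _).1, (hgB' ⟨z, hz⟩).2, by omega⟩

/-- The invariant of the search for a matching. -/
structure MatchInv (G : SimpleGraph (Fin n)) (S S' : Finset (Fin n)) (a b : Fin n)
    (s : Finset (Fin n) × (Fin n → Fin n)) : Prop where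
  left : ∀ p ∈ s.1, p ∈ S → p ∉ S'
  right : ∀ p ∈ s.1, p ∉ S → p ∈ S'
  indep : ∀ p ∈ s.1, ∀ q ∈ s.1, (p ∈ S ↔ q ∈ S) → ¬ G.Adj p q
  mu_eq : mu G s.1 = (s.1.filter (· ∈ S)).card
  card_eq : (s.1.filter (· ∉ S)).card = (s.1.filter (· ∈ S)).card
  moves : Moves G S ((S' \ s.1) ∪ (s.1.filter (· ∈ S))) s.2
  fixed : ∀ z ∈ s.1, z ∈ S → s.2 z = z
  attacked : s.2 a = b
  start : a ∉ s.1

/-- Equality of the cover numbers in the definition of `partner` ensures that the reduced bipartite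
graph still has a matching covering its side in `S`. The partner lies outside `S` by independence of
the sides, so it is still free. -/
theorem MatchInv.next {S S' : Finset (Fin n)} {a b : Fin n}
    {s : Finset (Fin n) × (Fin n → Fin n)} (h : MatchInv G S S' a b s) (z : Fin n) :
    MatchInv G S S' a b (matchStep G S s z) ∧ (matchStep G S s z).1 ⊆ s.1 ∧
      (z ∈ S → z ∉ (matchStep G S s z).1) := by
  unfold matchStep
  split
  swap
  · exact ⟨h, subset_rfl, by tauto⟩
  rename_i hz
  obtain ⟨hzS, hzR⟩ := hz
  obtain ⟨R, f⟩ := s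
  dsimp only at hzR ⊢
  have hR : R.filter (· ∈ S) ∪ R.filter (· ∉ S) = R := Finset.filter_union_filter_not_eq _ _
  have hz' : z ∈ R.filter (· ∈ S) := Finset.mem_filter.2 ⟨hzR, hzS⟩
  obtain ⟨h1, h2⟩ := exists_partner (G := G) (A := R.filter (· ∈ S)) (B := R.filter (· ∉ S))
    (Finset.disjoint_filter_filter_not _ _ _)
    (fun p hp q hq => h.indep p (Finset.mem_filter.1 hp).1 q (Finset.mem_filter.1 hq).1
      (by simp [(Finset.mem_filter.1 hp).2, (Finset.mem_filter.1 hq).2]))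
    (fun p hp q hq => h.indep p (Finset.mem_filter.1 hp).1 q (Finset.mem_filter.1 hq).1
      (by simp [(Finset.mem_filter.1 hp).2, (Finset.mem_filter.1 hq).2]))
    (by rw [hR]; exact h.mu_eq) hz'
  rw [hR] at h1 h2
  obtain ⟨hyR, hadj, hmu⟩ : partner G R z ∈ R ∧ G.Adj z (partner G R z) ∧
      mu G ((R.erase z).erase (partner G R z)) = mu G (R.erase z) := by
    obtain ⟨y, hy, ha, hm⟩ := h2
    exact pick_spec (P := fun y => y ∈ R ∧ G.Adj z y ∧
      mu G ((R.erase z).erase y) = mu G (R.erase z)) _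
      ⟨y, (Finset.mem_filter.1 hy).1, ha, hm.trans h1.symm⟩
  generalize partner G R z = y at hyR hadj hmu
  have hyS : y ∉ S := fun hyS => h.indep z hzR y hyR (by simp [hzS, hyS]) hadj
  have hne : y ≠ z := hadj.ne'
  have hsub : (R.erase z).erase y ⊆ R := (Finset.erase_subset _ _).trans (Finset.erase_subset _ _)
  have hl : ((R.erase z).erase y).filter (· ∈ S) = (R.filter (· ∈ S)).erase z := by
    ext x
    simp only [Finset.mem_filter, Finset.mem_erase]
    constructor
    · tauto
    · rintro ⟨h1, h2, h3⟩
      exact ⟨⟨by rintro rfl; exact hyS h3, h1, h2⟩, h3⟩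
  have hr : ((R.erase z).erase y).filter (· ∉ S) = (R.filter (· ∉ S)).erase y := by
    ext x
    simp only [Finset.mem_filter, Finset.mem_erase]
    constructor
    · tauto
    · rintro ⟨h1, h2, h3⟩
      exact ⟨⟨h1, by rintro rfl; exact h3 hzS, h2⟩, h3⟩
  refine ⟨⟨?_, ?_, ?_, ?_, ?_, ?_, ?_, ?_, ?_⟩, hsub, by simp⟩
  · exact fun p hp => h.left p (hsub hp)
  · exact fun p hp => h.right p (hsub hp)
  · exact fun p hp q hq => h.indep p (hsub hp) q (hsub hq)
  · dsimp only
    rw [hmu, h1, hl, Finset.card_erase_of_mem hz']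
  · dsimp only
    rw [hl, hr, Finset.card_erase_of_mem hz',
      Finset.card_erase_of_mem (Finset.mem_filter.2 ⟨hyR, hyS⟩)]
    exact congrArg (· - 1) h.card_eq
  · have := h.moves.update hzS hadj (h.fixed z hzR hzS) (by simp [hyR, hyS])
    dsimp only at this ⊢
    rw [hl]
    convert this using 1
    ext x
    have hyS' := h.right y hyR hyS
    have hzS' := h.left z hzR hzS
    simp only [Finset.mem_union, Finset.mem_sdiff, Finset.mem_erase, Finset.mem_insert,
      Finset.mem_filter]
    by_cases hxy : x = y
    · subst hxy
      simp [hyS']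
    · by_cases hxz : x = z
      · subst hxz
        simp [hzS', hxy]
      · simp [hxy, hxz]
  · intro p hp hpS
    dsimp only
    rw [Function.update_of_ne]
    · exact h.fixed p (hsub hp) hpS
    · rintro rfl
      simp at hp
  · dsimp only
    rw [Function.update_of_ne]
    · exact h.attacked
    · rintro rfl
      exact h.start hzR
  · exact fun ha => h.start (hsub ha)

theorem MatchInv.fold {S S' : Finset (Fin n)} {a b : Fin n}
    {s : Finset (Fin n) × (Fin n → Fin n)} (h : MatchInv G S S' a b s) (l : List (Fin n)) :
    MatchInv G S S' a b (l.foldl (matchStep G S) s) ∧ (l.foldl (matchStep G S) s).1 ⊆ s.1 ∧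
      ∀ z ∈ l, z ∈ S → z ∉ (l.foldl (matchStep G S) s).1 := by
  induction l generalizing s with
  | nil => exact ⟨h, subset_rfl, by simp⟩
  | cons w l ih =>
    obtain ⟨h1, h2, h3⟩ := h.next w
    obtain ⟨i1, i2, i3⟩ := ih h1
    refine ⟨i1, i2.trans h2, fun z hz hzS => ?_⟩
    rcases List.mem_cons.1 hz with rfl | hz
    · exact fun hcon => h3 hzS (i2 hcon)
    · exact i3 z hz hzS

/-- The end of the path is not known in advance, so the matching condition `hmu` is required for
every possible end `x`. -/
theorem shift_spec {S S' : Finset (Fin n)} {a b : Fin n} (hcard : S.card = S'.card)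
    (hb : b ∉ S) (hb' : b ∈ S') (hab : G.Adj a b) (hconn : Conn G S (S \ S') a)
    (hA : ∀ p ∈ S \ S', ∀ q ∈ S \ S', ¬ G.Adj p q)
    (hB : ∀ p ∈ S' \ S, ∀ q ∈ S' \ S, ¬ G.Adj p q)
    (hmu : ∀ x ∈ S \ S', (S \ S').card ≤ mu G (rest S S' x b) + 1) :
    Moves G S S' (shift G S S' a b) ∧ shift G S S' a b a = b := by
  obtain ⟨hp, hx⟩ := path_spec Finset.sdiff_subset hb hab hconn
  unfold shift
  generalize path G S (S \ S') a b = s at hp hx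
  obtain ⟨U, f, x⟩ := s
  dsimp only at hx ⊢
  have hxS := (Finset.mem_sdiff.1 hx).1
  have hxS' := (Finset.mem_sdiff.1 hx).2
  have hmem : ∀ w, w ∈ rest S S' x b ↔ (w ∈ S ∧ w ∉ S' ∨ w ∈ S' ∧ w ∉ S) ∧ w ≠ x ∧ w ≠ b := by
    simp [rest]
  have hl : (rest S S' x b).filter (· ∈ S) = (S \ S').erase x := by
    ext w
    simp only [Finset.mem_filter, hmem, Finset.mem_erase, Finset.mem_sdiff]
    constructor
    · tauto
    · rintro ⟨h1, h2, h3⟩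
      exact ⟨⟨.inl ⟨h2, h3⟩, h1, by rintro rfl; exact hb h2⟩, h2⟩
  have hr : (rest S S' x b).filter (· ∉ S) = (S' \ S).erase b := by
    ext w
    simp only [Finset.mem_filter, hmem, Finset.mem_erase, Finset.mem_sdiff]
    constructor
    · tauto
    · rintro ⟨h1, h2, h3⟩
      exact ⟨⟨.inr ⟨h2, h3⟩, by rintro rfl; exact hxS' h2, h1⟩, h3⟩
  have hc : (S \ S').card = (S' \ S).card := by
    have h1 := Finset.card_sdiff_add_card_inter S S'
    have h2 := Finset.card_sdiff_add_card_inter S' S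
    rw [Finset.inter_comm] at h2
    omega
  have hinv : MatchInv G S S' a b (rest S S' x b, f) := by
    refine ⟨?_, ?_, ?_, ?_, ?_, ?_, ?_, hp.attacked, ?_⟩
    · intro p hp hpS
      rw [hmem] at hp
      tauto
    · intro p hp hpS
      rw [hmem] at hp
      tauto
    · intro p hp q hq hpq
      rw [hmem] at hp hq
      by_cases hpS : p ∈ S
      · exact hA p (by simp; tauto) q (by simp; tauto)
      · exact hB p (by simp; tauto) q (by simp; tauto)
    · dsimp only
      rw [hl, Finset.card_erase_of_mem hx]
      have h1 := hmu x hx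
      refine le_antisymm ?_ (by omega)
      rw [← Finset.card_erase_of_mem hx, ← hl]
      refine mu_le fun p hp q hq hpq => ?_
      simp only [Finset.mem_filter, hp, hq, true_and]
      by_contra! hcon
      rw [hmem] at hp hq
      exact hB p (by simp; tauto) q (by simp; tauto) hpq
    · dsimp only
      rw [hl, hr, Finset.card_erase_of_mem hx, Finset.card_erase_of_mem (by simp [hb, hb']), hc]
    · dsimp only
      rw [hl]
      convert hp.moves using 1
      ext w
      simp only [Finset.mem_union, Finset.mem_sdiff, hmem, Finset.mem_erase, Finset.mem_insert]
      by_cases hwb : w = b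
      · subst hwb
        simp [hb']
      · by_cases hwx : w = x
        · subst hwx
          simp [hxS', hwb]
        · simp only [hwb, hwx, ne_eq, not_false_eq_true, true_and, and_true, false_or]
          tauto
    · intro z hz hzS
      rw [hmem] at hz
      exact hp.unvisited z (hp.targets (by simp; tauto)) (by tauto)
    -- If `a` were left to be matched, it would be an unvisited target whose guard has not moved,
    -- although that guard has moved to `b`.
    · intro ha
      rw [hmem] at ha
      have haS := hconn.mem
      have h1 := hp.unvisited a (hp.targets (by simp; tauto)) (by tauto)
      have h2 : f a = b := hp.attacked
      rw [show f a = a from h1] at h2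
      exact hb (h2 ▸ haS)
  obtain ⟨h1, -, h3⟩ := hinv.fold (List.finRange n)
  generalize (List.finRange n).foldl (matchStep G S) (rest S S' x b, f) = s at h1 h3
  -- All vertices of `S` have been processed, so the left side is used up; the sides have equal
  -- size, so the right side is empty too.
  have h4 : s.1.filter (· ∈ S) = ∅ :=
    Finset.filter_eq_empty_iff.2 fun z hz hzS => h3 z (List.mem_finRange z) hzS hz
  have h5 : s.1 = ∅ := by
    have h5 := h1.card_eq
    rw [h4, Finset.card_empty, Finset.card_eq_zero] at h5
    rw [← Finset.filter_union_filter_not_eq (· ∈ S) s.1, h4, h5, Finset.empty_union]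
  refine ⟨?_, h1.attacked⟩
  have := h1.moves
  rwa [h4, h5, Finset.sdiff_empty, Finset.union_empty] at this

end Shift

/-! ### The eternal vertex cover game -/

section Game

variable {n : ℕ} {G : SimpleGraph (Fin n)}

theorem evc_le {k : ℕ} {C : Set (Finset (Fin n))} (hC : IsEVCClass G k C) (h : C.Nonempty) :
    evc G ≤ k :=
  Nat.sInf_le ⟨C, h, hC⟩

theorem mvc_le_evc (G : SimpleGraph (Fin n)) : mvc G ≤ evc G := by
  obtain ⟨C, ⟨S, hS⟩, hC⟩ := evc_spec G
  obtain ⟨h1, h2⟩ := hC.1 S hS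
  exact h2 ▸ mvc_le h1

/-- The two sides of a cut vertex. -/
theorem exists_sides {x : Fin n} (hx : x ∈ cutSet G) :
    ∃ A : Finset (Fin n), x ∉ A ∧ (∀ p ∈ A, ∀ q, G.Adj p q → q ≠ x → q ∈ A) ∧
      (∃ y ∈ A, G.Adj y x) ∧ ∃ y, y ≠ x ∧ y ∉ A ∧ G.Adj y x := by
  obtain ⟨u, v, ⟨hu, hv⟩, h1, h2⟩ := isCutVertex_iff.1 (mem_cutSet.1 hx)
  have hvA : Conn G {x}ᶜ {v} v := .base (by simpa using hv) (by simp)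
  have hcl : ∀ p, Conn G {x}ᶜ {v} p → ∀ q, G.Adj p q → q ≠ x → Conn G {x}ᶜ {v} q :=
    fun p hp q hpq hq => .step (by simpa using hq) hpq.symm hp
  -- One side is the component of `v` after the removal of `x`. A walk from `u` to `v` can enter it
  -- only from `x`, and must reach `x` from a vertex outside it.
  refine ⟨Finset.univ.filter (Conn G {x}ᶜ {v}), ?_, by simpa using hcl, ?_, ?_⟩
  · simp only [Finset.mem_filter, Finset.mem_univ, true_and]
    intro h
    simpa using h.mem
  · have key : ∀ w, Conn G Finset.univ {v} w → ¬ Conn G {x}ᶜ {v} w →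
        ∃ p, Conn G {x}ᶜ {v} p ∧ G.Adj p x := by
      intro w hw
      induction hw with
      | base _ hT => exact fun hn => absurd ((Finset.mem_singleton.1 hT).symm ▸ hvA) hn
      | @step w w' _ ha _ ih =>
        intro hn
        by_cases hw' : Conn G {x}ᶜ {v} w'
        · by_cases hwx : w = x
          · exact ⟨w', hw', hwx ▸ ha.symm⟩
          · exact absurd (hcl _ hw' _ ha.symm hwx) hn
        · exact ih hw'
    simpa using key u h1 h2
  · have key : ∀ w, Conn G Finset.univ {v} w → w ≠ x → ¬ Conn G {x}ᶜ {v} w →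
        ∃ p, p ≠ x ∧ ¬ Conn G {x}ᶜ {v} p ∧ G.Adj p x := by
      intro w hw
      induction hw with
      | base _ hT => exact fun _ hn => absurd ((Finset.mem_singleton.1 hT).symm ▸ hvA) hn
      | @step w w' _ ha _ ih =>
        intro hwx hn
        by_cases hw' : w' = x
        · exact ⟨w, hwx, hn, hw' ▸ ha⟩
        · exact ih hw' fun h => hn (hcl _ h _ ha.symm hwx)
    simpa using key u h1 hu h2

/-- An attack on an edge from `x` to the side `D` takes a guard away from `D`. -/
theorem IsEVCClass.exists_fewer {k : ℕ} {C : Set (Finset (Fin n))} (hC : IsEVCClass G k C)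
    {S D : Finset (Fin n)} (hS : S ∈ C) {x y : Fin n} (hxS : x ∉ S) (hxD : x ∉ D)
    (hD : ∀ p ∈ D, ∀ q, G.Adj p q → q ≠ x → q ∈ D) (hy : y ∈ D) (hyx : G.Adj y x) :
    ∃ S' ∈ C, (S'.filter (· ∈ D)).card + 1 ≤ (S.filter (· ∈ D)).card := by
  obtain ⟨f, ⟨h1, -, h3⟩, h4⟩ := hC.2 S hS y x hyx
  obtain ⟨hyS, hfy⟩ := h3.resolve_right fun h => hxS h.1
  refine ⟨_, h4, ?_⟩
  -- Guards ending in `D` started in `D`, since the only outside neighbour of `D` is the empty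
  -- vertex `x`. The guard from `y` ends on `x`, outside `D`.
  have hsub : (S.image f).filter (· ∈ D) ⊆ ((S.filter (· ∈ D)).erase y).image f := by
    intro w hw
    obtain ⟨hw, hwD⟩ := Finset.mem_filter.1 hw
    obtain ⟨z, hz, rfl⟩ := Finset.mem_image.1 hw
    refine Finset.mem_image.2 ⟨z, Finset.mem_erase.2 ⟨?_, Finset.mem_filter.2 ⟨hz, ?_⟩⟩, rfl⟩
    · rintro rfl
      exact hxD (hfy ▸ hwD)
    · rcases h1 z hz with h | h
      · rwa [h] at hwD
      · exact hD _ hwD _ h.symm fun hzx => hxS (hzx ▸ hz)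
  have h5 := (Finset.card_le_card hsub).trans Finset.card_image_le
  have h6 := Finset.card_erase_add_one
    (Finset.mem_filter.2 ⟨hyS, hy⟩ : y ∈ S.filter (· ∈ D))
  omega

/-- With `mvc G` guards, all cut vertices are always occupied. -/
theorem IsEVCClass.cutSet_subset {C : Set (Finset (Fin n))} (hC : IsEVCClass G (mvc G) C)
    {S : Finset (Fin n)} (hS : S ∈ C) : cutSet G ⊆ S := by
  intro x hx
  by_contra hxS
  obtain ⟨A, hxA, hA, ⟨y₁, hy₁, hyx₁⟩, y₂, hy₂, hyA₂, hyx₂⟩ := exists_sides hx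
  let B : Finset (Fin n) := (insert x A)ᶜ
  have hmB : ∀ w, w ∈ B ↔ w ≠ x ∧ w ∉ A := by simp [B]
  obtain ⟨S₁, hS₁, hc₁⟩ := hC.exists_fewer hS hxS hxA hA hy₁ hyx₁
  obtain ⟨S₂, hS₂, hc₂⟩ := hC.exists_fewer (D := B) hS hxS (by simp [hmB])
    (fun p hp q hpq hq => by
      rw [hmB] at hp ⊢
      exact ⟨hq, fun hqA => hp.2 (hA q hqA p hpq.symm hp.1)⟩) ((hmB _).2 ⟨hy₂, hyA₂⟩) hyx₂
  -- No edge joins `A` to `B`, so the halves may come from different configurations. Each lost a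
  -- guard while only `x` is added, so the union has fewer than mvc elements.
  have hcov : G.IsVertexCover ((insert x (S₁.filter (· ∈ A) ∪ S₂.filter (· ∈ B)) :
      Finset (Fin n)) : Set (Fin n)) := by
    intro p q hpq
    have hp1 := (hC.1 S₁ hS₁).1 hpq
    have hp2 := (hC.1 S₂ hS₂).1 hpq
    simp only [Finset.mem_coe, Finset.mem_insert, Finset.mem_union, Finset.mem_filter, hmB]
      at hp1 hp2 ⊢
    by_cases hpx : p = x
    · tauto
    by_cases hqx : q = x
    · tauto
    by_cases hpA : p ∈ A
    · have := hA p hpA q hpq hqx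
      tauto
    · have : q ∉ A := fun h => hpA (hA q h p hpq.symm hpx)
      tauto
  have h1 := (mvc_le hcov).trans (Finset.card_insert_le _ _)
  have h2 := Finset.card_union_le (S₁.filter (· ∈ A)) (S₂.filter (· ∈ B))
  have h3 := Finset.card_filter_add_card_filter_not (s := S) (· ∈ A)
  have h4 : S.filter (· ∈ B) = S.filter (· ∉ A) := by
    refine Finset.filter_congr fun w hw => ?_
    rw [hmB]
    exact ⟨And.right, fun h => ⟨by rintro rfl; exact hxS hw, h⟩⟩
  rw [h4] at hc₂
  have h5 := (hC.1 S hS).2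
  omega

theorem extendable_of_evc_eq (h : evc G = mvc G) : Extendable G := by
  rw [extendable_iff]
  rintro v ⟨w, hvw⟩
  obtain ⟨C, ⟨S, hS⟩, hC⟩ := evc_spec G
  rw [h] at hC
  obtain ⟨S', hS', hv⟩ : ∃ S' ∈ C, v ∈ S' := by
    obtain ⟨f, ⟨-, -, h3⟩, h4⟩ := hC.2 S hS v w hvw
    rcases h3 with h3 | h3
    · exact ⟨S, hS, h3.1⟩
    · exact ⟨_, h4, Finset.mem_image.2 ⟨w, h3⟩⟩
  exact ⟨S', hC.1 S' hS', Finset.insert_subset hv (hC.cutSet_subset hS')⟩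

theorem Extendable.ext_cutSet (h : Extendable G) : Ext G (cutSet G) := by
  rw [extendable_iff] at h
  rcases (cutSet G).eq_empty_or_nonempty with hX | ⟨x, hx⟩
  · rw [hX]
    exact ext_empty G
  · obtain ⟨-, -, -, ⟨y, -, hy⟩, -⟩ := exists_sides hx
    exact (h x ⟨y, hy.symm⟩).mono (Finset.subset_insert _ _)

theorem Moves.isDefence {S Q : Finset (Fin n)} {f : Fin n → Fin n} (h : Moves G S Q f)
    {u v : Fin n} (huv : (u ∈ S ∧ f u = v) ∨ (v ∈ S ∧ f v = u)) : IsDefence G S u v f :=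
  ⟨h.adj, h.inj, huv⟩

theorem moves_swap {S : Finset (Fin n)} {u v : Fin n} (hu : u ∈ S) (hv : v ∈ S)
    (huv : G.Adj u v) : Moves G S S (Function.update (Function.update id u v) v u) := by
  have hf : Function.update (Function.update id u v) v u = Equiv.swap u v := by
    funext w
    simp only [Function.update_apply, Equiv.swap_apply_def, id]
    split_ifs with h1 h2 h3
    · subst h1
      exact absurd h2 huv.ne'
    · rfl
    · rfl
    · rfl
  rw [hf]
  refine ⟨fun w _ => ?_, (Equiv.swap u v).injective.injOn, ?_⟩
  · rw [Equiv.swap_apply_def]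
    split_ifs with h1 h2
    · exact .inr (h1 ▸ huv)
    · exact .inr (h2 ▸ huv.symm)
    · exact .inl rfl
  · ext w
    rw [Finset.mem_image]
    have hmem : ∀ w ∈ S, Equiv.swap u v w ∈ S := by
      intro w hw
      rw [Equiv.swap_apply_def]
      split_ifs <;> assumption
    constructor
    · rintro ⟨z, hz, rfl⟩
      exact hmem z hz
    · exact fun hw => ⟨_, hmem w hw, Equiv.swap_apply_self _ _ _⟩

/-- An attack between two occupied vertices is answered by a swap that preserves the configuration,
so only attacks with one empty end need an argument. -/
theorem answer_spec {C : Set (Finset (Fin n))} {S : Finset (Fin n)} (hS : S ∈ C)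
    (hc : G.IsVertexCover S)
    (h : ∀ a b, a ∈ S → b ∉ S → G.Adj a b → target G S b ∈ C ∧
      Moves G S (target G S b) (shift G S (target G S b) a b) ∧
        shift G S (target G S b) a b a = b) {u v : Fin n} (huv : G.Adj u v) :
    IsDefence G S u v (answer G S u v) ∧ S.image (answer G S u v) ∈ C := by
  unfold answer
  split_ifs with hu hv
  · have hm := moves_swap hu hv huv
    refine ⟨hm.isDefence (.inr ⟨hv, by simp⟩), ?_⟩
    rw [hm.image]
    exact hS
  · obtain ⟨h1, h2, h3⟩ := h u v hu hv huv
    refine ⟨h2.isDefence (.inl ⟨hu, h3⟩), ?_⟩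
    rw [h2.image]
    exact h1
  · have hv : v ∈ S := (hc huv).resolve_left hu
    obtain ⟨h1, h2, h3⟩ := h v u hv hu huv.symm
    refine ⟨h2.isDefence (.inr ⟨hv, h3⟩), ?_⟩
    rw [h2.image]
    exact h1

/-- If `S'` is a minimum vertex cover containing `X` and `b` whose intersection with `S` is
maximal, then the vertices that are matched after a path has been used have a perfect matching. -/
theorem card_le_mu_rest {X S S' : Finset (Fin n)} {b x : Fin n} (hS : G.IsVertexCover S)
    (hSc : S.card = mvc G) (hXS : X ⊆ S) (hb : b ∉ S) (hS' : G.IsVertexCover S') (hXS' : X ⊆ S')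
    (hmax : ∀ T : Finset (Fin n), G.IsVertexCover T → T.card = mvc G → insert b X ⊆ T →
      (∀ w ∈ S, w ∈ S' → w ∈ T) → ∀ w ∈ S, w ∈ T → w ∈ S')
    (hx : x ∈ S \ S') : (S \ S').card ≤ mu G (rest S S' x b) + 1 := by
  by_contra! hcon
  obtain ⟨T₀, hT₀, hcov, hc⟩ := exists_mu G (rest S S' x b)
  have hmem : ∀ w, w ∈ rest S S' x b ↔ (w ∈ S ∧ w ∉ S' ∨ w ∈ S' ∧ w ∉ S) ∧ w ≠ x ∧ w ≠ b := by
    simp [rest]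
  -- From a too small cover `T₀` of the remaining bipartite graph an exchange produces `T`: `S`
  -- gives up the vertices of `S \ S'` other than `x` that `T₀` does not use, and receives `b` and
  -- the part of `T₀` outside `S`.
  let A := ((S \ S').erase x) \ T₀
  have hmA : ∀ w, w ∈ A ↔ (w ≠ x ∧ w ∈ S ∧ w ∉ S') ∧ w ∉ T₀ := by simp [A]
  let T := (S \ A) ∪ insert b (T₀ \ S)
  have hmT : ∀ w, w ∈ T ↔ (w ∈ S ∧ w ∉ A) ∨ w = b ∨ (w ∈ T₀ ∧ w ∉ S) := by
    simp [T, or_left_comm]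
  have key : ∀ p q, G.Adj p q → p ∈ S → p ∈ T ∨ q ∈ T := by
    intro p q hpq hp
    -- A neighbour of a removed vertex lies in `S'`. It is kept if it is in `S`; otherwise it is `b`
    -- or must be in `T₀`.
    by_cases hpA : p ∈ A
    · right
      rw [hmT]
      have hpA' := (hmA p).1 hpA
      have hqS' : q ∈ S' := (hS' hpq).resolve_left hpA'.1.2.2
      by_cases hqS : q ∈ S
      · exact .inl ⟨hqS, fun h => ((hmA q).1 h).1.2.2 hqS'⟩
      · by_cases hqb : q = b
        · exact .inr (.inl hqb)
        · refine .inr (.inr ⟨?_, hqS⟩)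
          refine (hcov p ((hmem p).2 ⟨.inl hpA'.1.2, hpA'.1.1, ?_⟩) q
            ((hmem q).2 ⟨.inr ⟨hqS', hqS⟩, ?_, hqb⟩) hpq).resolve_left hpA'.2
          · rintro rfl
            exact hb hp
          · rintro rfl
            exact hqS (Finset.mem_sdiff.1 hx).1
    · exact .inl ((hmT p).2 (.inl ⟨hp, hpA⟩))
  have hT : G.IsVertexCover T := by
    intro p q hpq
    rcases hS hpq with hp | hq
    · exact key p q hpq hp
    · exact (key q p hpq.symm hq).symm
  -- At least `|S \ S'| - 1 - |T₀ ∩ S|` vertices leave and at most `1 + |T₀ \ S|` enter. The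
  -- assumption `|T₀| + 2 ≤ |S \ S'|` makes this balance.
  have hTc : T.card ≤ S.card := by
    have h1 := Finset.card_union_le (S \ A) (insert b (T₀ \ S))
    have h2 := Finset.card_insert_le b (T₀ \ S)
    have h3 : A ⊆ S := fun w hw => ((hmA w).1 hw).1.2.1
    have h4 := Finset.card_sdiff_add_card_eq_card h3
    have h5 := Finset.card_erase_add_one hx
    have h6 := Finset.le_card_sdiff (T₀ ∩ S) ((S \ S').erase x)
    have h7 : ((S \ S').erase x) \ (T₀ ∩ S) = A := by
      ext w
      simp only [Finset.mem_sdiff, Finset.mem_inter, Finset.mem_erase, hmA]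
      tauto
    rw [h7] at h6
    have h8 := Finset.card_sdiff_add_card_inter T₀ S
    have h9 : T.card ≤ (S \ A).card + (insert b (T₀ \ S)).card := h1
    omega
  -- `T` is thus a minimum cover that keeps `S ∩ S'` and in addition contains `x`, against
  -- maximality.
  have h1 := hmax T hT (le_antisymm (hTc.trans hSc.le) (mvc_le hT))
    (Finset.insert_subset ((hmT b).2 (by simp))
      fun w hw => (hmT w).2 (.inl ⟨hXS hw, fun h => ((hmA w).1 h).1.2.2 (hXS' hw)⟩))
    (fun w hw hw' => (hmT w).2 (.inl ⟨hw, fun h => ((hmA w).1 h).1.2.2 hw'⟩))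
    x (Finset.mem_sdiff.1 hx).1
    ((hmT x).2 (.inl ⟨(Finset.mem_sdiff.1 hx).1, fun h => ((hmA x).1 h).1.1 rfl⟩))
  exact (Finset.mem_sdiff.1 hx).2 h1

/-- Inserting members of `S` changes nothing, so the test keeps succeeding until the first new
vertex is added and fails from then on. -/
theorem addOne_spec {S : Finset (Fin n)} (h : S ≠ Finset.univ) :
    ∃ w ∉ S, addOne S = insert w S := by
  have key : ∀ (l : List (Fin n)) (w : Fin n), w ∉ S → l.foldl
      (fun Q w => if ∀ x, x ∈ Q → x ∈ S then insert w Q else Q) (insert w S) = insert w S := by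
    intro l w hw
    induction l with
    | nil => rfl
    | cons z l ih =>
      rw [List.foldl_cons, if_neg, ih]
      exact fun h => hw (h w (Finset.mem_insert_self _ _))
  have key' : ∀ l : List (Fin n), (∃ w ∈ l, w ∉ S) → ∃ w ∉ S, l.foldl
      (fun Q w => if ∀ x, x ∈ Q → x ∈ S then insert w Q else Q) S = insert w S := by
    intro l
    induction l with
    | nil => simp
    | cons z l ih =>
      rintro ⟨w, hw, hwS⟩
      rw [List.foldl_cons, if_pos fun _ h => h]
      by_cases hz : z ∈ S
      · rw [Finset.insert_eq_of_mem hz]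
        refine ih ⟨w, (List.mem_cons.1 hw).resolve_left ?_, hwS⟩
        rintro rfl
        exact hwS hz
      · exact ⟨z, hz, key l z hz⟩
  refine key' _ ?_
  by_contra! hcon
  exact h (Finset.eq_univ_iff_forall.2 fun w => hcon w (List.mem_finRange w))

end Game

/-! ### Connected components -/

section Components

variable {n : ℕ} {G : SimpleGraph (Fin n)}

/-- A walk that starts in a set closed under adjacency never leaves it, so it lives in the induced
subgraph. -/
theorem Conn.pull {K U T : Finset (Fin n)} (hK : ∀ p ∈ K, ∀ q, G.Adj p q → q ∈ K) {w : Fin n}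
    (h : Conn G U T w) (i : Fin (sub G K).1) (hi : subEmb G K i = w) :
    Conn (sub G K).2 (Finset.univ.filter (subEmb G K · ∈ U))
      (Finset.univ.filter (subEmb G K · ∈ T)) i := by
  induction h generalizing i with
  | base hw ht =>
    subst hi
    exact .base (by simpa using hw) (by simpa using ht)
  | @step w w' hw ha _ ih =>
    subst hi
    obtain ⟨j, rfl⟩ :=
      (exists_subEmb_iff (G := G)).2 (hK _ (subEmb_mem i) _ ha)
    exact .step (by simpa using hw) ((subEmb G K).map_adj_iff.1 ha) (ih j rfl)

theorem Conn.push {K U T : Finset (Fin n)} {U' T' : Finset (Fin (sub G K).1)}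
    (hU : ∀ i ∈ U', subEmb G K i ∈ U) (hT : ∀ i ∈ T', subEmb G K i ∈ T) {i : Fin (sub G K).1}
    (h : Conn (sub G K).2 U' T' i) : Conn G U T (subEmb G K i) := by
  induction h with
  | base hw ht => exact .base (hU _ hw) (hT _ ht)
  | step hw ha _ ih => exact .step (hU _ hw) ((subEmb G K).map_adj_iff.2 ha) ih

theorem filter_subEmb_singleton {K : Finset (Fin n)} (j : Fin (sub G K).1) :
    Finset.univ.filter (subEmb G K · ∈ ({subEmb G K j} : Finset (Fin n))) = {j} := by
  ext i
  simp

variable {H : FinGraph → Prop}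

/-- A minimum vertex cover that contains all cut vertices is connected inside each component. -/
theorem conn_of_reachable (hH : IsHereditary H)
    (hF : ∀ G : FinGraph, H G → G.2.Connected → InClassF G.2) (hG : H ⟨n, G⟩)
    {S : Finset (Fin n)} (hS : G.IsVertexCover S) (hSc : S.card = mvc G) (hX : cutSet G ⊆ S)
    {a z : Fin n} (ha : a ∈ S) (hz : z ∈ S) (haz : G.Reachable a z) : Conn G S {z} a := by
  let K : Finset (Fin n) := Finset.univ.filter (G.Reachable a)
  have hmK : ∀ w, w ∈ K ↔ G.Reachable a w := by simp [K]
  have hK : ∀ p ∈ K, ∀ q, G.Adj p q → q ∈ K := by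
    intro p hp q hpq
    rw [hmK] at hp ⊢
    exact hp.trans hpq.reachable
  obtain ⟨i₀, hi₀⟩ := (exists_subEmb_iff (G := G)).2 ((hmK a).2 .rfl)
  obtain ⟨j₀, hj₀⟩ := (exists_subEmb_iff (G := G)).2 ((hmK z).2 haz)
  have hpre : ∀ i j, (sub G K).2.Reachable i j := by
    intro i j
    have h1 : G.Reachable (subEmb G K i) (subEmb G K j) :=
      ((hmK _).1 (subEmb_mem i)).symm.trans ((hmK _).1 (subEmb_mem j))
    have h2 := (conn_univ_iff.2 h1).pull hK i rfl
    rw [filter_subEmb_singleton] at h2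
    exact conn_univ_iff.1 (h2.mono (Finset.subset_univ _) subset_rfl)
  have hconn : (sub G K).2.Connected :=
    { preconnected := hpre
      nonempty := ⟨i₀⟩ }
  let S₁ : Finset (Fin (sub G K).1) := Finset.univ.filter (subEmb G K · ∈ S)
  have hcov : (sub G K).2.IsVertexCover S₁ := by
    intro i j hij
    simpa [S₁] using hS ((subEmb G K).map_adj_iff.2 hij)
  -- A smaller cover of the component could replace `S ∩ K` in `S`, since no edge leaves `K`.
  have hcard : S₁.card = mvc (sub G K).2 := by
    refine le_antisymm ?_ (mvc_le hcov)
    obtain ⟨T, hT, hTc⟩ := exists_mvc (sub G K).2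
    rw [← hTc]
    have h1 : G.IsVertexCover (((S \ K) ∪ T.map (subEmb G K).toEmbedding : Finset (Fin n)) :
        Set (Fin n)) := by
      intro p q hpq
      simp only [Finset.mem_coe, Finset.mem_union, Finset.mem_sdiff]
      by_cases hp : p ∈ K
      · obtain ⟨i, rfl⟩ := (exists_subEmb_iff (G := G)).2 hp
        obtain ⟨j, rfl⟩ := (exists_subEmb_iff (G := G)).2 (hK _ hp q hpq)
        rcases hT ((subEmb G K).map_adj_iff.1 hpq) with h | h
        · exact .inl (.inr (Finset.mem_map.2 ⟨i, h, rfl⟩))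
        · exact .inr (.inr (Finset.mem_map.2 ⟨j, h, rfl⟩))
      · have hq : q ∉ K := fun hq => hp (hK q hq p hpq.symm)
        have := hS hpq
        simp only [Finset.mem_coe] at this
        tauto
    have h2 := (mvc_le h1).trans (Finset.card_union_le _ _)
    rw [Finset.card_map, ← hSc] at h2
    have h3 := Finset.card_sdiff_add_card_inter S K
    have h4 : S₁.card = (S ∩ K).card := by
      rw [← Finset.card_map (subEmb G K).toEmbedding]
      congr 1
      ext w
      simp only [Finset.mem_map, Finset.mem_filter, Finset.mem_univ, true_and, Finset.mem_inter,
        S₁]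
      constructor
      · rintro ⟨i, hi, rfl⟩
        exact ⟨hi, subEmb_mem i⟩
      · rintro ⟨hw, hwK⟩
        obtain ⟨i, rfl⟩ := (exists_subEmb_iff (G := G)).2 hwK
        exact ⟨i, hw, rfl⟩
    omega
  -- A cut vertex of the component is one of `G`: a walk in `G` avoiding it and starting in `K`
  -- would stay in `K`.
  have hcut : ∀ i, IsCutVertex (sub G K).2 i → i ∈ S₁ := by
    intro i hi
    obtain ⟨u, v, ⟨hu, hv⟩, -, h2⟩ := isCutVertex_iff.1 hi
    refine Finset.mem_filter.2 ⟨Finset.mem_univ _, hX (mem_cutSet.2 (isCutVertex_iff.2 ?_))⟩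
    refine ⟨subEmb G K u, subEmb G K v, ⟨by simpa using hu, by simpa using hv⟩, ?_, fun h => h2 ?_⟩
    · exact conn_univ_iff.2 ((hpre u v).map (subEmb G K).toHom)
    · have h3 := h.pull hK u rfl
      rw [filter_subEmb_singleton] at h3
      refine h3.mono (fun j hj => ?_) subset_rfl
      simpa using hj
  have hpc := (hF (sub G K) (hH ⟨n, G⟩ _ hG ⟨subEmb G K⟩) hconn).2 S₁ hcov hcard hcut
  have hi : i₀ ∈ S₁ := by simp [S₁, hi₀, ha]
  have hj : j₀ ∈ S₁ := by simp [S₁, hj₀, hz]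
  have h := (conn_singleton_iff (U := S₁) (W := (S₁ : Set _)) (by simp)).2
    ⟨hi, hj, hpc ⟨i₀, hi⟩ ⟨j₀, hj⟩⟩
  rw [← hi₀]
  exact h.push (by simp [S₁]) (by simp [hj₀])

/-! ### Correctness of the strategy -/

/-- The configurations of the strategy. -/
def configs (G : SimpleGraph (Fin n)) : Set (Finset (Fin n)) :=
  {S | if Extendable G then (G.IsVertexCover S ∧ S.card = mvc G) ∧ cutSet G ⊆ S
    else ∃ w ∉ greedyCover G (cutSet G) ∅, S = insert w (greedyCover G (cutSet G) ∅)}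

theorem answer_of_extendable (hH : IsHereditary H)
    (hF : ∀ G : FinGraph, H G → G.2.Connected → InClassF G.2) (hG : H ⟨n, G⟩)
    (hE : Extendable G) {S : Finset (Fin n)} (hS : S ∈ configs G) {u v : Fin n}
    (huv : G.Adj u v) :
    IsDefence G S u v (answer G S u v) ∧ S.image (answer G S u v) ∈ configs G := by
  have hS' := hS
  rw [configs, Set.mem_ofPred, if_pos hE] at hS'
  obtain ⟨⟨hc, hSc⟩, hX⟩ := hS'
  refine answer_spec hS hc (fun a b ha hb hab => ?_) huv
  have hext : Ext G (insert b (cutSet G)) := extendable_iff.1 hE b ⟨a, hab.symm⟩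
  obtain ⟨htc, htcard⟩ := greedyCover_cover G (insert b (cutSet G)) S
  have hsub := subset_greedyCover (S := S) hext
  have hmax := fun T h1 h2 h3 h4 w h5 h6 =>
    greedyCover_maximal (G := G) (X := insert b (cutSet G)) (S := S) (T := T) h1 h2 h3 h4
      (w := w) h5 h6
  rw [target, if_pos hE]
  generalize greedyCover G (insert b (cutSet G)) S = S' at *
  have hbS' : b ∈ S' := hsub (Finset.mem_insert_self _ _)
  have hXS' : cutSet G ⊆ S' := (Finset.subset_insert _ _).trans hsub
  -- All neighbours of `b` are in `S`. If all of them were also in `S'`, then `b` would be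
  -- superfluous in the minimum cover `S'`. The neighbour `z` puts a target of the path into the
  -- component of `a`, as needed when `G` is disconnected.
  obtain ⟨z, hz, hbz⟩ : ∃ z ∈ S \ S', G.Adj b z := by
    by_contra! hcon
    have h1 : G.IsVertexCover ((S'.erase b : Finset (Fin n)) : Set (Fin n)) := by
      have key : ∀ p q, G.Adj p q → p ∈ S' → p ∈ S'.erase b ∨ q ∈ S'.erase b := by
        intro p q hpq hp
        by_cases hpb : p = b
        · subst hpb
          right
          have hq : q ∈ S := (hc hpq).resolve_left hb
          refine Finset.mem_erase.2 ⟨hpq.ne', ?_⟩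
          by_contra hqS'
          exact hcon q (Finset.mem_sdiff.2 ⟨hq, hqS'⟩) hpq
        · exact .inl (Finset.mem_erase.2 ⟨hpb, hp⟩)
      intro p q hpq
      rcases htc hpq with h | h
      · exact key p q hpq h
      · exact (key q p hpq.symm h).symm
    have h2 := mvc_le h1
    have h3 := Finset.card_erase_add_one hbS'
    omega
  refine ⟨?_, shift_spec (hSc.trans htcard.symm) hb hbS' hab ?_ ?_ ?_ ?_⟩
  · rw [configs, Set.mem_ofPred, if_pos hE]
    exact ⟨⟨htc, htcard⟩, hXS'⟩
  · exact (conn_of_reachable hH hF hG hc hSc hX ha (Finset.mem_sdiff.1 hz).1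
      (hab.reachable.trans hbz.reachable)).mono subset_rfl (by simpa using hz)
  · intro p hp q hq hpq
    simp only [Finset.mem_sdiff] at hp hq
    exact (htc hpq).elim hp.2 hq.2
  · intro p hp q hq hpq
    simp only [Finset.mem_sdiff] at hp hq
    exact (hc hpq).elim hp.2 hq.2
  · exact fun x hx => card_le_mu_rest hc hSc hX hb htc hXS' hmax hx

theorem cutSet_eq_empty (hB : IsBiconnected G) : cutSet G = ∅ := by
  ext x
  simp [mem_cutSet, hB.2 x]

/-- Configurations differ only in the position of the surplus guard. Without cut vertices every
minimum cover falls under the connectedness condition of F, so the surplus can be shifted through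
the fixed cover, and nothing remains to be matched. -/
theorem answer_of_isBiconnected (hH : IsHereditary H)
    (hF : ∀ G : FinGraph, H G → G.2.Connected → InClassF G.2) (hG : H ⟨n, G⟩)
    (hB : IsBiconnected G) (hE : ¬ Extendable G) {S : Finset (Fin n)} (hS : S ∈ configs G)
    {u v : Fin n} (huv : G.Adj u v) :
    IsDefence G S u v (answer G S u v) ∧ S.image (answer G S u v) ∈ configs G := by
  have hS' := hS
  rw [configs, Set.mem_ofPred, if_neg hE] at hS'
  obtain ⟨w, hw, rfl⟩ := hS'
  obtain ⟨hc, hcard⟩ := greedyCover_cover G (cutSet G) ∅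
  refine answer_spec hS (hc.subset (by simp)) (fun a b ha hb hab => ?_) huv
  have hmem : target G (insert w (greedyCover G (cutSet G) ∅)) b ∈ configs G := by
    rw [target, if_neg hE, configs, Set.mem_ofPred, if_neg hE]
    exact ⟨b, fun h => hb (Finset.mem_insert_of_mem h), rfl⟩
  refine ⟨hmem, ?_⟩
  rw [target, if_neg hE]
  clear hmem hS
  have hconn := fun a z => conn_of_reachable (a := a) (z := z) hH hF hG hc hcard
    (by simp [cutSet_eq_empty hB])
  generalize greedyCover G (cutSet G) ∅ = S₀ at *
  simp only [Finset.mem_insert, not_or] at hb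
  have haS : a ∈ S₀ := (hc hab).resolve_right hb.2
  have hwa : w ≠ a := by
    rintro rfl
    exact hw haS
  have hd : insert w S₀ \ insert b S₀ = {w} := by
    ext x
    simp only [Finset.mem_sdiff, Finset.mem_insert, Finset.mem_singleton]
    constructor
    · tauto
    · rintro rfl
      exact ⟨.inl rfl, not_or.2 ⟨Ne.symm hb.1, hw⟩⟩
  have hd' : insert b S₀ \ insert w S₀ = {b} := by
    ext x
    simp only [Finset.mem_sdiff, Finset.mem_insert, Finset.mem_singleton]
    constructor
    · tauto
    · rintro rfl
      exact ⟨.inl rfl, not_or.2 hb⟩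
  refine shift_spec ?_ (by simp [hb]) (by simp) hab ?_ ?_ ?_ ?_
  · rw [Finset.card_insert_of_notMem hw, Finset.card_insert_of_notMem hb.2]
  · rw [hd]
    obtain ⟨w', hww'⟩ : ∃ w', G.Adj w w' := by
      obtain ⟨p⟩ := hB.1.preconnected w a
      cases p with
      | nil => exact absurd rfl hwa
      | cons h _ => exact ⟨_, h⟩
    have hw' : w' ∈ S₀ := (hc hww').resolve_left hw
    have h := hconn a w' haS hw' (hB.1.preconnected _ _)
    -- A walk inside the cover to the neighbour `w'` of `w` is prolonged by the edge to `w`.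
    have key : ∀ z, Conn G S₀ {w'} z → Conn G (insert w S₀) {w} z := by
      intro z hz
      induction hz with
      | base hz hT =>
        obtain rfl := Finset.mem_singleton.1 hT
        exact .step (Finset.mem_insert_of_mem hz) hww'.symm (.base (by simp) (by simp))
      | step hz ha _ ih => exact .step (Finset.mem_insert_of_mem hz) ha ih
    exact key a h
  · simp [hd]
  · simp [hd']
  · simp [hd]

theorem exists_guards (hH : IsHereditary H)
    (hF : ∀ G : FinGraph, H G → G.2.Connected → InClassF G.2) (hG : H ⟨n, G⟩)
    (hB : Extendable G ∨ IsBiconnected G) :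
    evc G = (if Extendable G then mvc G else mvc G + 1) ∧ IsEVCClass G (evc G) (configs G) ∧
      startConf G ∈ configs G ∧ ∀ S ∈ configs G, ∀ u v, G.Adj u v →
        IsDefence G S u v (answer G S u v) ∧ S.image (answer G S u v) ∈ configs G := by
  have hans : ∀ S ∈ configs G, ∀ u v, G.Adj u v →
      IsDefence G S u v (answer G S u v) ∧ S.image (answer G S u v) ∈ configs G := by
    intro S hS u v huv
    by_cases hE : Extendable G
    · exact answer_of_extendable hH hF hG hE hS huv
    · exact answer_of_isBiconnected hH hF hG (hB.resolve_left hE) hE hS huv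
  have hstart : startConf G ∈ configs G := by
    rw [configs, Set.mem_ofPred, startConf]
    split_ifs with hE
    · exact ⟨greedyCover_cover _ _ _, subset_greedyCover hE.ext_cutSet⟩
    -- An unoccupied vertex exists for the surplus guard: omitting any one vertex leaves a cover, so
    -- mvc is less than `n`.
    · refine addOne_spec fun h => ?_
      obtain ⟨-, h2⟩ := greedyCover_cover G (cutSet G) ∅
      obtain ⟨v⟩ := (hB.resolve_left hE).1.nonempty
      have h3 : G.IsVertexCover ((Finset.univ.erase v : Finset (Fin n)) : Set (Fin n)) := by
        intro p q hpq
        by_cases hp : p = v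
        · subst hp
          exact .inr (by simpa using hpq.ne')
        · exact .inl (by simpa using hp)
      have h4 := mvc_le h3
      have h5 := Finset.card_erase_add_one (Finset.mem_univ v)
      rw [h] at h2
      omega
  have hclass : IsEVCClass G (if Extendable G then mvc G else mvc G + 1) (configs G) := by
    refine ⟨fun S hS => ?_, fun S hS u v huv => ⟨_, hans S hS u v huv⟩⟩
    rw [configs, Set.mem_ofPred] at hS
    split_ifs at hS ⊢ with hE
    · exact hS.1
    · obtain ⟨w, hw, rfl⟩ := hS
      obtain ⟨h1, h2⟩ := greedyCover_cover G (cutSet G) ∅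
      exact ⟨h1.subset (by simp), by rw [Finset.card_insert_of_notMem hw, h2]⟩
  have heq : evc G = if Extendable G then mvc G else mvc G + 1 := by
    refine le_antisymm (evc_le hclass ⟨_, hstart⟩) ?_
    have h1 := mvc_le_evc G
    split_ifs with hE
    · exact h1
    · have : evc G ≠ mvc G := fun h => hE (extendable_of_evc_eq h)
      omega
  exact ⟨heq, heq ▸ hclass, hstart, hans⟩

theorem evc_eq_mvc_iff (hH : IsHereditary H)
    (hF : ∀ G : FinGraph, H G → G.2.Connected → InClassF G.2) (hG : H ⟨n, G⟩) :
    Extendable G ↔ evc G = mvc G := by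
  refine ⟨fun h => ?_, extendable_of_evc_eq⟩
  rw [(exists_guards hH hF hG (.inl h)).1, if_pos h]

end Components

/-- A graph from the class `H`, a configuration, and a pair of vertices. -/
abbrev Round (H : FinGraph → Prop) : Type :=
  {r : Σ G : FinGraph, Finset (Fin G.1) × Fin G.1 × Fin G.1 // H r.1}

theorem hasPolyTimeStrategyOn {H : FinGraph → Prop} (hH : IsHereditary H)
    (hF : ∀ G : FinGraph, H G → G.2.Connected → InClassF G.2)
    (hmvc : PolyTimeComputableOn H fun G => mvc G.2) {P : FinGraph → Prop}
    (hP : ∀ G, P G → H G ∧ (Extendable G.2 ∨ IsBiconnected G.2)) :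
    HasPolyTimeStrategyOn P := by
  obtain ⟨p, q, hp⟩ : PT (fun G : {G // H G} => encGraph G.1) fun G => encSet (startConf G.1.2) :=
    PT.startConf (G := fun G : {G // H G} => G.1.2) (PT.refl _) hH hmvc fun G => G.2
  obtain ⟨p', q', hp'⟩ : PT
      (fun r : Round H =>
        encRound r.1.1 r.1.2.1 r.1.2.2.1 r.1.2.2.2)
      fun r => encMap (answer r.1.1.2 r.1.2.1 r.1.2.2.1 r.1.2.2.2) := by
    have h := PT.refl
      fun r : Round H =>
        encRound r.1.1 r.1.2.1 r.1.2.2.1 r.1.2.2.2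
    exact PT.answer (n := fun r : Round H => r.1.1.1) (G := fun r => r.1.1.2)
      (S := fun r => r.1.2.1) (a := fun r => r.1.2.2.1) (b := fun r => r.1.2.2.2) h.fst hH hmvc (fun r => r.2)
      h.snd.fst h.snd.snd.fst h.snd.snd.snd
  refine ⟨p, p', q + q', fun G hG => ?_⟩
  obtain ⟨hHG, hB⟩ := hP G hG
  obtain ⟨-, h1, h2, h3⟩ := exists_guards hH hF hHG hB
  refine ⟨configs G.2, h1, ⟨_, h2, ?_⟩, fun S hS u v huv => ⟨_, (h3 S hS u v huv).1,
    (h3 S hS u v huv).2, ?_⟩⟩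
  · exact (hp ⟨G, hHG⟩).mono (by simp)
  · exact (hp' ⟨⟨G, S, u, v⟩, hHG⟩).mono (by simp)

end EternalVC

/-! ### Decision procedure, strategies and the biconnected case -/

theorem mainTheorem6 (H : EternalVC.FinGraph → Prop)
    (hH : EternalVC.IsHereditary H)
    (hF : ∀ G : EternalVC.FinGraph, H G → G.2.Connected → EternalVC.InClassF G.2)
    (hmvc : EternalVC.PolyTimeComputableOn H (fun G => EternalVC.mvc G.2)) :
    EternalVC.PolyTimeDecidableOn H (fun G => EternalVC.evc G.2 = EternalVC.mvc G.2) ∧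
    EternalVC.HasPolyTimeStrategyOn (fun G => H G ∧ EternalVC.evc G.2 = EternalVC.mvc G.2) ∧
    (EternalVC.PolyTimeComputableOn (fun G => H G ∧ EternalVC.IsBiconnected G.2)
        (fun G => EternalVC.evc G.2) ∧
      EternalVC.HasPolyTimeStrategyOn (fun G => H G ∧ EternalVC.IsBiconnected G.2)) := by
  classical
  have hE : EternalVC.PT (fun G : {G // H G} => EternalVC.encGraph G.1)
      fun G => EternalVC.encBool (EternalVC.Extendable G.1.2) :=
    EternalVC.PT.extendable (G := fun G : {G // H G} => G.1.2) (EternalVC.PT.refl _) hH hmvc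
      fun G => G.2
  refine ⟨?_, ?_, ?_, ?_⟩
  · obtain ⟨p, q, hp⟩ := hE
    refine ⟨p, q, fun G hG => ?_⟩
    have h : EternalVC.RunsLe p (EternalVC.encGraph G)
      (EternalVC.encBool (EternalVC.Extendable G.2)) _ := hp ⟨G, hG⟩
    rwa [propext (EternalVC.evc_eq_mvc_iff hH hF hG)] at h
  · exact EternalVC.hasPolyTimeStrategyOn hH hF hmvc fun G hG =>
      ⟨hG.1, .inl (EternalVC.extendable_of_evc_eq hG.2)⟩
  · have hm : EternalVC.PT (fun G : {G // H G} => EternalVC.encGraph G.1)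
        fun G => EternalVC.encNat (EternalVC.mvc G.1.2) := by
      obtain ⟨p, q, h⟩ := hmvc
      exact ⟨p, q, fun G => h G.1 G.2⟩
    -- In the biconnected case evc is mvc or mvc + 1 according to extendability; prepending a leaf
    -- is the successor in unary.
    obtain ⟨p, q, hp⟩ := hE.ite hm ((EternalVC.PT.nil _).pair hm)
    refine ⟨p, q, fun G hG => ?_⟩
    have h := hp ⟨G, hG.1⟩
    have heq := (EternalVC.exists_guards hH hF hG.1 (.inr hG.2)).1
    have : (if EternalVC.Extendable G.2 then EternalVC.encNat (EternalVC.mvc G.2)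
        else .cons .nil (EternalVC.encNat (EternalVC.mvc G.2))) =
          EternalVC.encNat (EternalVC.evc G.2) := by
      rw [heq]
      split_ifs
      · rfl
      · simp [EternalVC.encNat, EternalVC.encList, List.replicate_succ]
    rw [← this]
    exact h
  · exact EternalVC.hasPolyTimeStrategyOn hH hF hmvc fun G hG => ⟨hG.1, .inr hG.2⟩
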